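/- Let $n\ge 1$ and let $p(\cdot):\mathbb R^n\to[1,\infty)$ be a measurable function with $p_+:=\operatorname{ess\,sup}p<\infty$. For measurable $f$ put $$\|f\|_{p(\cdot)}:=\inf\Big\{\mu>0:\int_{\mathbb R^n}(|f(x)|/\mu)^{p(x)}\,dx\le 1\Big\}\in[0,\infty].$$ Let $\mathcal Q$ be the family of all (half-open) cubes in $\mathbb R^n$ with sides parallel to the axes. Assume that $p(\cdot)\in\mathcal A_\infty$, that is, there exist $\lambda\in(0,1)$ and $C>0$ such that $$\Big\|\sum_{Q\in\mathcal F}t_Q\chi_Q\Big\|_{p(\cdot)}\le C\Big\|\sum_{Q\in\mathcal F}t_Q\chi_{E_Q}\Big\|_{p(\cdot)}$$ for every family $\mathcal F\subset\mathcal Q$ of pairwise disjoint cubes, all numbers $t_Q\ge 0$ $(Q\in\mathcal F)$ and all measurable sets $E_Q\subset Q$ with $|E_Q|\ge\lambda|Q|$. Then there exist $\eta,\delta\in(0,1)$ and a function $b:\mathcal Q\to[0,1]$ such that for every cube $Q\in\mathcal Q$, every measurable set $E\subset Q$ with $|E|\ge\eta|Q|$ and every $t\in(0,1/\|\chi_Q\|_{p(\cdot)}]$,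 $$\int_Q t^{p(x)}\,dx\le 2\Big(\int_E t^{p(x)}\,dx+t^\delta\, b(Q)\,\chi_{(0,1)}(t)\Big),$$ and, moreover, $\sum_{Q\in\mathcal F}b(Q)\le 1$ for every family $\mathcal F\subset\mathcal Q$ of pairwise disjoint cubes. -/

import Mathlib

open MeasureTheory
open scoped ENNReal

/-- An axis-parallel cube in `ℝⁿ`, given by its lower corner and its (positive) side length. -/
structure Cube (n : ℕ) where
  corner : Fin n → ℝ
  side : ℝ
  side_pos : 0 < side

/-- The point set of a cube, with the half-open convention `∏ i, [aᵢ, aᵢ + ℓ)`. Two such sets are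
disjoint exactly when the corresponding open cubes are. -/
def Cube.toSet {n : ℕ} (Q : Cube n) : Set (Fin n → ℝ) :=
  {x | ∀ i, x i ∈ Set.Ico (Q.corner i) (Q.corner i + Q.side)}

/-- A family of pairwise disjoint cubes. -/
def DisjointCubes {n : ℕ} (F : Set (Cube n)) : Prop :=
  F.Pairwise fun Q R => Disjoint Q.toSet R.toSet

/-- The Luxemburg norm `inf {l > 0 : ∫ (|f(x)| / l) ^ p(x) dx ≤ 1}` of the variable Lebesgue space
`L^{p(·)}(ℝⁿ)`, as an extended number (it is `∞` when there is no such `l`). -/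
noncomputable def varNorm {n : ℕ} (p f : (Fin n → ℝ) → ℝ) : ℝ≥0∞ :=
  ⨅ (l : ℝ) (_ : 0 < l) (_ : ∫⁻ x, ENNReal.ofReal ((|f x| / l) ^ p x) ≤ 1), ENNReal.ofReal l

/-- The function `∑_{Q ∈ F} t_Q χ_{E_Q}`. When `E_Q ⊆ Q` and the cubes of `F` are pairwise disjoint,
at most one term is nonzero at each point. -/
noncomputable def stepFun {n : ℕ} (F : Set (Cube n)) (t : Cube n → ℝ)
    (E : Cube n → Set (Fin n → ℝ)) (x : Fin n → ℝ) : ℝ :=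
  ∑' Q : F, (E Q).indicator (fun _ => t Q) x

/-- The condition `p(·) ∈ 𝒜_∞`. (`NullMeasurableSet` is Lebesgue measurability.) -/
def AInfty {n : ℕ} (p : (Fin n → ℝ) → ℝ) : Prop :=
  ∃ lam C : ℝ, 0 < lam ∧ lam < 1 ∧ 0 < C ∧
    ∀ (F : Set (Cube n)) (t : Cube n → ℝ) (E : Cube n → Set (Fin n → ℝ)),
      DisjointCubes F →
      (∀ Q ∈ F, 0 ≤ t Q) →
      (∀ Q ∈ F, NullMeasurableSet (E Q) volume ∧ E Q ⊆ Q.toSet ∧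
        ENNReal.ofReal lam * volume Q.toSet ≤ volume (E Q)) →
      varNorm p (stepFun F t Cube.toSet) ≤ ENNReal.ofReal C * varNorm p (stepFun F t E)

open MeasureTheory
open scoped ENNReal

/-! ### Cubes -/

/-! Call a level `t < 1` bad for `Q` if the modular of `t` on `Q` is at most 1 and some `G ⊆ Q` of
relative measure at most `θ ^ M` carries at least half of it. At levels that are not bad, the set
`E` carries half of the modular, so the error term `b` only has to pay for bad levels.

Decay. If sets of relative measure `1 - lam` carried nearly all of a unit modular, the rest would
have tiny norm, and `𝒜_∞` would make the whole norm small, a contradiction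
(`AInfty.exists_hasModularDecay`). Iterating along Calderón–Zygmund cubes makes the decay a power of
the relative measure, uniformly over disjoint families (`HasModularDecay.pow`).

Self-improvement. At a bad level, `t ^ p` is concentrated on a small set. Slicing `G` by the size of
`t ^ p` and applying decay to the slices shows that the modulars of `t ^ (1 - d)`, `0 ≤ d ≤ δ`,
summed over disjoint cubes with bad levels, cannot lie in `(1/2, 1]` (`tsum_modularOn_le_half`).
This gap, with continuity in `d` and induction on the number of cubes, bounds every such sum at `d =
δ` by `1/2`. Since `p ≥ 1` and `t < 1`, `t ^ (-δ) ∫_Q t ^ p` is at most the modular of `t ^ (1 -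
δ)`; its supremum over bad `t` is `b(Q)`, which is therefore summable with sum at most 1
(`tsum_badSup_le_one`).

For `t ≥ 1` no error is needed: interpolating between exponent 0 and the level `T ≥ t` of full
modular shows that small sets never carry half (`two_mul_modularOn_le_of_one_le`). -/

lemma Cube.toSet_eq_pi {n : ℕ} (Q : Cube n) :
    Q.toSet = Set.univ.pi fun i => Set.Ico (Q.corner i) (Q.corner i + Q.side) := by
  ext x; simp [Cube.toSet]

lemma Cube.measurableSet_toSet {n : ℕ} (Q : Cube n) : MeasurableSet Q.toSet := by
  rw [Q.toSet_eq_pi]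
  exact MeasurableSet.univ_pi fun _ => measurableSet_Ico

lemma Cube.volume_toSet {n : ℕ} (Q : Cube n) :
    volume Q.toSet = ENNReal.ofReal (Q.side ^ n) := by
  rw [Q.toSet_eq_pi, Real.volume_pi_Ico]
  simp [ENNReal.ofReal_pow Q.side_pos.le]

lemma Cube.volume_ne_zero {n : ℕ} (Q : Cube n) : volume Q.toSet ≠ 0 := by
  rw [Q.volume_toSet]
  simpa using pow_pos Q.side_pos n

lemma Cube.volume_ne_top {n : ℕ} (Q : Cube n) : volume Q.toSet ≠ ⊤ := by
  rw [Q.volume_toSet]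
  exact ENNReal.ofReal_ne_top

lemma Cube.corner_mem {n : ℕ} (Q : Cube n) : Q.corner ∈ Q.toSet := fun i => by
  simpa using Q.side_pos

lemma Cube.countable_of_pairwise_disjoint {n : ℕ} {ι : Type*} {c : ι → Cube n}
    (hc : Pairwise (Function.onFun Disjoint fun i => (c i).toSet)) : Countable ι := by
  have h := Measure.countable_meas_pos_of_disjoint_iUnion (μ := volume)
    (fun i => (c i).measurableSet_toSet) hc
  have : {i | 0 < volume (c i).toSet} = Set.univ := by
    ext i; simpa using pos_iff_ne_zero.2 (c i).volume_ne_zero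
  rw [this] at h
  exact Set.countable_univ_iff.1 h

/-! ### Dyadic subcubes -/

/-- The cube of generation `k` and index `m` in the dyadic grid generated by `Q`. -/
noncomputable def dyadicCube {n : ℕ} (Q : Cube n) (k : ℕ) (m : Fin n → ℤ) : Cube n where
  corner i := Q.corner i + Q.side / 2 ^ k * m i
  side := Q.side / 2 ^ k
  side_pos := div_pos Q.side_pos (by positivity)

/-- The index of the dyadic cube of generation `k` containing `x`. -/
noncomputable def dyadicIndex {n : ℕ} (Q : Cube n) (k : ℕ) (x : Fin n → ℝ) : Fin n → ℤ :=
  fun i => ⌊(x i - Q.corner i) / (Q.side / 2 ^ k)⌋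

/-- The dyadic cube of generation `k` containing `x`. -/
noncomputable def dyadicCubeAt {n : ℕ} (Q : Cube n) (k : ℕ) (x : Fin n → ℝ) : Cube n :=
  dyadicCube Q k (dyadicIndex Q k x)

lemma mem_dyadicCube {n : ℕ} {Q : Cube n} {k : ℕ} {m : Fin n → ℤ} {x : Fin n → ℝ} :
    x ∈ (dyadicCube Q k m).toSet ↔ dyadicIndex Q k x = m := by
  have hs : 0 < Q.side / 2 ^ k := div_pos Q.side_pos (by positivity)
  simp only [Cube.toSet, dyadicCube, dyadicIndex, Set.mem_ofPred_eq, Set.mem_Ico, funext_iff,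
    Int.floor_eq_iff, le_div_iff₀ hs, div_lt_iff₀ hs]
  refine forall_congr' fun i => and_congr ?_ ?_ <;> constructor <;> intro h <;> linarith

lemma mem_dyadicCubeAt {n : ℕ} {Q : Cube n} {k : ℕ} {x y : Fin n → ℝ} :
    y ∈ (dyadicCubeAt Q k x).toSet ↔ dyadicIndex Q k y = dyadicIndex Q k x :=
  mem_dyadicCube

lemma dyadicIndex_succ {n : ℕ} (Q : Cube n) (k : ℕ) (x : Fin n → ℝ) :
    dyadicIndex Q k x = fun i => dyadicIndex Q (k + 1) x i / 2 := by
  funext i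
  have := Int.floor_div_natCast ((x i - Q.corner i) / (Q.side / 2 ^ (k + 1))) 2
  simp only [dyadicIndex]
  push_cast at this
  rw [← this]
  congr 1
  have := Q.side_pos
  field_simp
  ring

lemma dyadicIndex_eq_of_le {n : ℕ} {Q : Cube n} {k l : ℕ} (hkl : k ≤ l) {x y : Fin n → ℝ}
    (h : dyadicIndex Q l x = dyadicIndex Q l y) : dyadicIndex Q k x = dyadicIndex Q k y := by
  induction l, hkl using Nat.le_induction with
  | base => exact h
  | succ l _ ih =>
    apply ih
    rw [dyadicIndex_succ, dyadicIndex_succ Q l y, h]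

lemma dyadicCubeAt_eq {n : ℕ} {Q : Cube n} {k : ℕ} {x y : Fin n → ℝ}
    (h : dyadicIndex Q k x = dyadicIndex Q k y) : dyadicCubeAt Q k x = dyadicCubeAt Q k y := by
  simp [dyadicCubeAt, h]

lemma dyadicCubeAt_subset_of_le {n : ℕ} (Q : Cube n) {k l : ℕ} (hkl : k ≤ l) (x : Fin n → ℝ) :
    (dyadicCubeAt Q l x).toSet ⊆ (dyadicCubeAt Q k x).toSet := fun _ hy =>
  mem_dyadicCubeAt.2 (dyadicIndex_eq_of_le hkl (mem_dyadicCubeAt.1 hy))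

lemma dyadicCubeAt_zero {n : ℕ} {Q : Cube n} {x : Fin n → ℝ} (hx : x ∈ Q.toSet) :
    dyadicCubeAt Q 0 x = Q := by
  have h0 : dyadicCube Q 0 0 = Q := by
    cases Q; simp [dyadicCube]
  have : dyadicIndex Q 0 x = 0 := by
    rw [← mem_dyadicCube, h0]; exact hx
  rw [dyadicCubeAt, this, h0]

lemma volume_dyadicCubeAt_succ {n : ℕ} (Q : Cube n) (k : ℕ) (x : Fin n → ℝ) :
    volume (dyadicCubeAt Q k x).toSet
      = ENNReal.ofReal (2 ^ n) * volume (dyadicCubeAt Q (k + 1) x).toSet := by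
  rw [Cube.volume_toSet, Cube.volume_toSet, ← ENNReal.ofReal_mul (by positivity), ← mul_pow]
  congr 2
  simp only [dyadicCubeAt, dyadicCube]
  rw [pow_succ]
  field_simp

lemma exists_dyadicCubeAt_subset {n : ℕ} (Q : Cube n) {U : Set (Fin n → ℝ)} (hU : IsOpen U)
    {x : Fin n → ℝ} (hx : x ∈ U) : ∃ k, (dyadicCubeAt Q k x).toSet ⊆ U := by
  obtain ⟨e, he, hball⟩ := Metric.isOpen_iff.1 hU x hx
  obtain ⟨k, hk⟩ := exists_pow_lt_of_lt_one (div_pos he Q.side_pos)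
    (show (1 / 2 : ℝ) < 1 by norm_num)
  have hs : Q.side / 2 ^ k < e := by
    rw [lt_div_iff₀ Q.side_pos] at hk
    calc Q.side / 2 ^ k = (1 / 2) ^ k * Q.side := by rw [one_div, inv_pow]; ring
      _ < e := hk
  refine ⟨k, fun y hy => hball ?_⟩
  have hx' : x ∈ (dyadicCubeAt Q k x).toSet := mem_dyadicCubeAt.2 rfl
  rw [Metric.mem_ball, dist_pi_lt_iff he]
  intro i
  have h1 := hy i
  have h2 := hx' i
  have h3 : (dyadicCubeAt Q k x).side = Q.side / 2 ^ k := rfl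
  rw [h3] at h1 h2
  rw [Real.dist_eq, abs_lt]
  constructor <;> linarith [h1.1, h1.2, h2.1, h2.2]

/-- Calderón–Zygmund stopping cubes: a set of small relative measure in `Q` is covered by disjoint
subcubes of small total measure, in each of which its density is still small. -/
lemma exists_stopping_cubes {n : ℕ} (Q : Cube n) {G : Set (Fin n → ℝ)} {κ a : ℝ} (hκ : κ < 1)
    (ha : 0 < a) (haκ : 2 * a ≤ κ) (hGQ : G ⊆ Q.toSet)
    (hG : volume G ≤ ENNReal.ofReal a * volume Q.toSet) :
    ∃ (ι : Type) (P : ι → Cube n),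
      Pairwise (Function.onFun Disjoint fun j => (P j).toSet) ∧
      (∀ j, (P j).toSet ⊆ Q.toSet) ∧ G ⊆ ⋃ j, (P j).toSet ∧
      (∀ j, volume (G ∩ (P j).toSet) ≤ ENNReal.ofReal (2 ^ n * κ) * volume (P j).toSet) ∧
      volume (⋃ j, (P j).toSet) ≤ ENNReal.ofReal (2 * a / κ) * volume Q.toSet := by
  have hκ0 : 0 < κ := by linarith
  have hlt : volume G < ENNReal.ofReal (2 * a) * volume Q.toSet := by
    refine hG.trans_lt ?_
    rw [ENNReal.mul_lt_mul_iff_left Q.volume_ne_zero Q.volume_ne_top]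
    exact (ENNReal.ofReal_lt_ofReal_iff (by linarith)).2 (by linarith)
  -- Stopping on the density of an open `U ⊇ G` rather than of `G` covers every point of `G`: small
  -- dyadic cubes around it lie inside `U`, so no null set is lost and `G` need not be measurable.
  obtain ⟨U, hGU, hUo, hU⟩ := Set.exists_isOpen_lt_of_lt G _ hlt
  let dense : Cube n → Prop := fun P => ENNReal.ofReal κ * volume P.toSet < volume (U ∩ P.toSet)
  have hex : ∀ x ∈ G, ∃ k, dense (dyadicCubeAt Q k x) := by
    intro x hx
    obtain ⟨k, hk⟩ := exists_dyadicCubeAt_subset Q hUo (hGU hx)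
    refine ⟨k, ?_⟩
    simp only [dense]
    rw [Set.inter_eq_right.2 hk]
    conv_rhs => rw [← one_mul (volume _)]
    rw [ENNReal.mul_lt_mul_iff_left (Cube.volume_ne_zero _) (Cube.volume_ne_top _)]
    simpa using hκ
  -- Maximal dense cubes. `Q` itself is not dense because `2 * a ≤ κ`, so each has a non-dense
  -- parent, and passing to the parent costs the factor `2 ^ n`.
  let S : Set (Cube n) := {P | ∃ x ∈ G, ∃ k, P = dyadicCubeAt Q k x ∧ dense P ∧
    ∀ l < k, ¬ dense (dyadicCubeAt Q l x)}
  have hdisj : Pairwise (Function.onFun Disjoint fun j : S => (j : Cube n).toSet) := by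
    have key : ∀ x k y l z, k ≤ l → dense (dyadicCubeAt Q k x) →
        (∀ i < l, ¬ dense (dyadicCubeAt Q i y)) → z ∈ (dyadicCubeAt Q k x).toSet →
        z ∈ (dyadicCubeAt Q l y).toSet → dyadicCubeAt Q k x = dyadicCubeAt Q l y := by
      intro x k y l z hkl hd hmin hz hz'
      have h1 := mem_dyadicCubeAt.1 hz
      have h2 := mem_dyadicCubeAt.1 hz'
      have h3 := dyadicIndex_eq_of_le hkl h2
      have h4 : dyadicCubeAt Q k x = dyadicCubeAt Q k y := dyadicCubeAt_eq (h1.symm.trans h3)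
      rcases hkl.lt_or_eq with h | h
      · exact absurd (h4 ▸ hd) (hmin k h)
      · rw [h4, h]
    rintro ⟨P, x, hx, k, rfl, hP, hk⟩ ⟨P', y, hy, l, rfl, hP', hl⟩ hne
    rw [Function.onFun, Set.disjoint_left]
    intro z hz hz'
    apply hne
    rw [Subtype.mk.injEq]
    rcases le_total k l with h | h
    · exact key x k y l z h hP hl hz hz'
    · exact (key y l x k z h hP' hk hz' hz).symm
  refine ⟨S, fun j => j, hdisj, ?_, ?_, ?_, ?_⟩
  · rintro ⟨P, x, hx, k, rfl, hP, hk⟩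
    have := dyadicCubeAt_subset_of_le Q (Nat.zero_le k) x
    rwa [dyadicCubeAt_zero (hGQ hx)] at this
  · intro x hx
    classical
    refine Set.mem_iUnion.2 ⟨⟨dyadicCubeAt Q (Nat.find (hex x hx)) x, x, hx, _, rfl,
      Nat.find_spec (hex x hx), fun l hl => Nat.find_min (hex x hx) hl⟩, mem_dyadicCubeAt.2 rfl⟩
  · rintro ⟨P, x, hx, k, rfl, hP, hk⟩
    rcases k with _ | k
    · exfalso
      simp only [dense] at hP
      rw [dyadicCubeAt_zero (hGQ hx)] at hP
      refine absurd ((measure_mono Set.inter_subset_left).trans (hU.le.trans ?_)) (not_le.2 hP)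
      gcongr
    · have h1 := not_lt.1 (hk k (Nat.lt_succ_self k))
      calc volume (G ∩ (dyadicCubeAt Q (k + 1) x).toSet)
          ≤ volume (U ∩ (dyadicCubeAt Q k x).toSet) := by
            refine measure_mono (Set.inter_subset_inter hGU ?_)
            exact dyadicCubeAt_subset_of_le Q (Nat.le_succ k) x
        _ ≤ ENNReal.ofReal κ * volume (dyadicCubeAt Q k x).toSet := h1
        _ = _ := by
            rw [volume_dyadicCubeAt_succ, ← mul_assoc, ← ENNReal.ofReal_mul hκ0.le, mul_comm κ]
  · have hcount : Countable S := Cube.countable_of_pairwise_disjoint hdisj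
    have hκ' : ENNReal.ofReal κ ≠ 0 := by simpa using hκ0
    have h1 : ENNReal.ofReal κ * volume (⋃ j : S, (j : Cube n).toSet) ≤ volume U := by
      rw [measure_iUnion hdisj (fun j => (j : Cube n).measurableSet_toSet), ← ENNReal.tsum_mul_left]
      calc ∑' j : S, ENNReal.ofReal κ * volume (j : Cube n).toSet
          ≤ ∑' j : S, volume (U ∩ (j : Cube n).toSet) := by
            refine ENNReal.tsum_le_tsum ?_
            rintro ⟨P, x, hx, k, rfl, hP, hk⟩
            exact hP.le
        _ = volume (⋃ j : S, U ∩ (j : Cube n).toSet) := by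
            rw [measure_iUnion]
            · exact fun i j hij => (hdisj hij).mono Set.inter_subset_right Set.inter_subset_right
            · exact fun j => hUo.measurableSet.inter (j : Cube n).measurableSet_toSet
        _ ≤ volume U := measure_mono (Set.iUnion_subset fun j => Set.inter_subset_left)
    rw [ENNReal.ofReal_div_of_pos hκ0, ENNReal.mul_comm_div, ← mul_div_assoc,
      ENNReal.le_div_iff_mul_le (Or.inl hκ') (Or.inl ENNReal.ofReal_ne_top), mul_comm]
    exact h1.trans hU.le

/-! ### Bounded exponents and modulars -/

/-- A measurable exponent with values in `[1, K]`. -/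
structure IsBoundedExponent {n : ℕ} (p : (Fin n → ℝ) → ℝ) (K : ℝ) : Prop where
  measurable : Measurable p
  one_le : ∀ x, 1 ≤ p x
  le : ∀ x, p x ≤ K

/-- The modular `∫_S t ^ p(x) dx` of the constant `t` on the set `S`. -/
noncomputable def modularOn {n : ℕ} (p : (Fin n → ℝ) → ℝ) (S : Set (Fin n → ℝ)) (t : ℝ) : ℝ≥0∞ :=
  ∫⁻ x in S, ENNReal.ofReal (t ^ p x)

section modular

variable {n : ℕ} {p : (Fin n → ℝ) → ℝ} {K : ℝ}

lemma IsBoundedExponent.pos (hp : IsBoundedExponent p K) (x : Fin n → ℝ) : 0 < p x :=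
  zero_lt_one.trans_le (hp.one_le x)

lemma IsBoundedExponent.one_le_bound (hp : IsBoundedExponent p K) : 1 ≤ K :=
  (hp.one_le 0).trans (hp.le 0)

lemma IsBoundedExponent.measurable_rpow (hp : IsBoundedExponent p K) (t : ℝ) :
    Measurable fun x => ENNReal.ofReal (t ^ p x) :=
  (measurable_const.pow hp.measurable).ennreal_ofReal

lemma modularOn_mono_set {S S' : Set (Fin n → ℝ)} (h : S ⊆ S') (t : ℝ) :
    modularOn p S t ≤ modularOn p S' t :=
  lintegral_mono_set h

lemma modularOn_mono (hp : IsBoundedExponent p K) (S : Set (Fin n → ℝ)) {s t : ℝ} (hs : 0 ≤ s)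
    (hst : s ≤ t) : modularOn p S s ≤ modularOn p S t :=
  lintegral_mono fun x => ENNReal.ofReal_le_ofReal (Real.rpow_le_rpow hs hst (hp.pos x).le)

/-- This scaling law uses `p ≤ K`, its companion `mul_modularOn_le` uses `1 ≤ p`; together they
translate between norms and modulars. -/
lemma modularOn_mul_le (hp : IsBoundedExponent p K) (S : Set (Fin n → ℝ)) {r t : ℝ} (hr : 1 ≤ r)
    (ht : 0 ≤ t) : modularOn p S (r * t) ≤ ENNReal.ofReal (r ^ K) * modularOn p S t := by
  rw [modularOn, modularOn, ← lintegral_const_mul _ (hp.measurable_rpow t)]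
  refine lintegral_mono fun x => ?_
  rw [← ENNReal.ofReal_mul (by positivity), Real.mul_rpow (by linarith) ht]
  refine ENNReal.ofReal_le_ofReal ?_
  gcongr
  exact hp.le x

lemma mul_modularOn_le (hp : IsBoundedExponent p K) (S : Set (Fin n → ℝ)) {r t : ℝ} (hr : 1 ≤ r)
    (ht : 0 ≤ t) : ENNReal.ofReal r * modularOn p S t ≤ modularOn p S (r * t) := by
  rw [modularOn, modularOn, ← lintegral_const_mul _ (hp.measurable_rpow t)]
  refine lintegral_mono fun x => ?_
  rw [← ENNReal.ofReal_mul (by linarith), Real.mul_rpow (by linarith) ht]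
  refine ENNReal.ofReal_le_ofReal ?_
  gcongr
  simpa using Real.rpow_le_rpow_of_exponent_le hr (hp.one_le x)

lemma modularOn_union {S S' : Set (Fin n → ℝ)} (hS' : NullMeasurableSet S')
    (h : Disjoint S S') (t : ℝ) :
    modularOn p (S ∪ S') t = modularOn p S t + modularOn p S' t := by
  simp only [modularOn]
  rw [Measure.restrict_union₀ h.aedisjoint hS', lintegral_add_measure]

lemma modularOn_iUnion {ι : Type*} [Countable ι] {S : ι → Set (Fin n → ℝ)}
    (hS : ∀ i, NullMeasurableSet (S i)) (h : Pairwise (Function.onFun Disjoint S)) (t : ℝ) :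
    modularOn p (⋃ i, S i) t = ∑' i, modularOn p (S i) t :=
  lintegral_iUnion₀ hS (fun _ _ hij => (h hij).aedisjoint) _

/-- The modular of a step function over disjoint cubes. -/
lemma lintegral_stepFun (hp : IsBoundedExponent p K) {ι : Type*} {c : ι → Cube n}
    (hc : Pairwise (Function.onFun Disjoint fun i => (c i).toSet)) (hinj : Function.Injective c)
    {t : Cube n → ℝ} {E : Cube n → Set (Fin n → ℝ)} (ht : ∀ i, 0 ≤ t (c i))
    (hE : ∀ i, NullMeasurableSet (E (c i))) (hEc : ∀ i, E (c i) ⊆ (c i).toSet) (l : ℝ) :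
    ∫⁻ x, ENNReal.ofReal ((|stepFun (Set.range c) t E x| / l) ^ p x) =
      ∑' i, modularOn p (E (c i)) (t (c i) / l) := by
  have := Cube.countable_of_pairwise_disjoint hc
  have hpt : ∀ x, ENNReal.ofReal ((|stepFun (Set.range c) t E x| / l) ^ p x) =
      ∑' i, (E (c i)).indicator (fun x => ENNReal.ofReal ((t (c i) / l) ^ p x)) x := by
    intro x
    rw [stepFun, tsum_range (fun Q : Cube n => (E Q).indicator (fun _ => t Q) x) hinj]
    by_cases hx : ∃ i, x ∈ E (c i)
    · obtain ⟨i, hi⟩ := hx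
      have hne : ∀ j ≠ i, x ∉ E (c j) := fun j hj hxj =>
        Set.disjoint_left.1 (hc hj) (hEc j hxj) (hEc i hi)
      rw [tsum_eq_single i fun j hj => Set.indicator_of_notMem (hne j hj) _,
        tsum_eq_single i fun j hj => Set.indicator_of_notMem (hne j hj) _,
        Set.indicator_of_mem hi, Set.indicator_of_mem hi, abs_of_nonneg (ht i)]
    · push Not at hx
      simp only [Set.indicator_of_notMem (hx _), tsum_zero, abs_zero, zero_div,
        Real.zero_rpow (hp.pos x).ne', ENNReal.ofReal_zero]
  simp_rw [hpt]
  rw [lintegral_tsum fun i => (hp.measurable_rpow _).aemeasurable.indicator₀ (hE i)]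
  exact tsum_congr fun i => lintegral_indicator₀ (hE i) _

end modular

/-! ### Decay of modulars on small subsets of cubes -/

/-- For any disjoint cubes `c i` and subsets `G i` of relative measure at most `g`, the modular
unit ball of the `c i` is mapped to that of the `G i` by division by `r`. -/
def HasModularDecay {n : ℕ} (p : (Fin n → ℝ) → ℝ) (g r : ℝ) : Prop :=
  ∀ {ι : Type} (c : ι → Cube n) (t : ι → ℝ) (G : ι → Set (Fin n → ℝ)),
    Pairwise (Function.onFun Disjoint fun i => (c i).toSet) → (∀ i, 0 ≤ t i) →
    (∀ i, NullMeasurableSet (G i)) → (∀ i, G i ⊆ (c i).toSet) →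
    (∀ i, volume (G i) ≤ ENNReal.ofReal g * volume (c i).toSet) →
    ∑' i, modularOn p (c i).toSet (t i) ≤ 1 → ∑' i, modularOn p (G i) (t i / r) ≤ 1

lemma Cube.injective_of_pairwise_disjoint {n : ℕ} {ι : Type*} {c : ι → Cube n}
    (hc : Pairwise (Function.onFun Disjoint fun i => (c i).toSet)) : Function.Injective c := by
  intro i j hij
  by_contra hne
  exact Set.disjoint_left.1 (hc hne) (c i).corner_mem (hij ▸ (c i).corner_mem)

/-- If decay failed, the `G i` would carry modular above `ρ ^ K = 1 - l ^ K`, leaving at most `l ^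
K` on the complements, hence norm at most `l` there. By `𝒜_∞` the full step function has norm below
`1/2`, so, as `p ≥ 1`, modular below `1/2`. But `ρ ^ K ≥ 1/2`. -/
lemma AInfty.exists_hasModularDecay {n : ℕ} {p : (Fin n → ℝ) → ℝ} {K : ℝ}
    (hp : IsBoundedExponent p K) (hA : AInfty p) :
    ∃ lam ρ : ℝ, 0 < lam ∧ lam < 1 ∧ 0 < ρ ∧ ρ < 1 ∧ HasModularDecay p (1 - lam) ρ := by
  obtain ⟨lam, C, hl0, hl1, hC, hA⟩ := hA
  have hK : 0 < K := zero_lt_one.trans_le hp.one_le_bound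
  set l : ℝ := min (1 / 2) (1 / (4 * C)) with hl
  have hlpos : 0 < l := by positivity
  have hl2 : l ≤ 1 / 2 := min_le_left _ _
  have hCl : C * l ≤ 1 / 4 := by
    calc C * l ≤ C * (1 / (4 * C)) := by gcongr; exact min_le_right _ _
      _ = 1 / 4 := by field_simp
  have hlK : l ^ K ≤ 1 / 2 := by
    calc l ^ K ≤ l ^ (1 : ℝ) :=
          Real.rpow_le_rpow_of_exponent_ge hlpos (by linarith) hp.one_le_bound
      _ ≤ 1 / 2 := by simpa using hl2
  have hlK0 : 0 < l ^ K := by positivity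
  set ρ : ℝ := (1 - l ^ K) ^ K⁻¹ with hρ
  have hρ0 : 0 < ρ := Real.rpow_pos_of_pos (by linarith) _
  have hρ1 : ρ < 1 := Real.rpow_lt_one (by linarith) (by linarith) (by positivity)
  have hρK : ρ ^ K = 1 - l ^ K := Real.rpow_inv_rpow (by linarith) hK.ne'
  refine ⟨lam, ρ, hl0, hl1, hρ0, hρ1, ?_⟩
  intro ι c t G hc ht hG hGc hvol hsum
  by_contra! hcon
  have hinj := Cube.injective_of_pairwise_disjoint hc
  -- `AInfty` indexes its data by cubes; disjoint cubes are distinct, so data indexed by `ι`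
  -- transfers along `c`.
  set t' : Cube n → ℝ := Function.extend c t 0
  set E : Cube n → Set (Fin n → ℝ) := Function.extend c (fun i => (c i).toSet \ G i) fun _ => ∅
  have ht' : ∀ i, t' (c i) = t i := fun i => hinj.extend_apply _ _ _
  have hE : ∀ i, E (c i) = (c i).toSet \ G i := fun i => hinj.extend_apply _ _ _
  have hEm : ∀ i, NullMeasurableSet (E (c i)) := fun i => by
    rw [hE]; exact (c i).measurableSet_toSet.nullMeasurableSet.diff (hG i)
  -- most of the modular lives on the sets `G i`
  have hGbig : ENNReal.ofReal (ρ ^ K) < ∑' i, modularOn p (G i) (t i) := by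
    have h1 : ∑' i, modularOn p (G i) (t i / ρ) ≤
        ENNReal.ofReal (ρ⁻¹ ^ K) * ∑' i, modularOn p (G i) (t i) := by
      rw [← ENNReal.tsum_mul_left]
      refine ENNReal.tsum_le_tsum fun i => ?_
      rw [div_eq_inv_mul]
      exact modularOn_mul_le hp _ ((one_le_inv₀ hρ0).2 hρ1.le) (ht i)
    have h2 := hcon.trans_le h1
    have h3 : ENNReal.ofReal (ρ ^ K) * ENNReal.ofReal (ρ⁻¹ ^ K) = 1 := by
      rw [← ENNReal.ofReal_mul (by positivity), ← Real.mul_rpow hρ0.le (by positivity),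
        mul_inv_cancel₀ hρ0.ne', Real.one_rpow, ENNReal.ofReal_one]
    have h4 : ENNReal.ofReal (ρ ^ K) ≠ 0 := by simpa using Real.rpow_pos_of_pos hρ0 K
    calc ENNReal.ofReal (ρ ^ K) = ENNReal.ofReal (ρ ^ K) * 1 := (mul_one _).symm
      _ < ENNReal.ofReal (ρ ^ K) *
          (ENNReal.ofReal (ρ⁻¹ ^ K) * ∑' i, modularOn p (G i) (t i)) := by
        rwa [ENNReal.mul_lt_mul_iff_right h4 ENNReal.ofReal_ne_top]
      _ = _ := by rw [← mul_assoc, h3, one_mul]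
  have hsplit : ∑' i, modularOn p (c i).toSet (t i) =
      ∑' i, modularOn p (E (c i)) (t i) + ∑' i, modularOn p (G i) (t i) := by
    rw [← ENNReal.tsum_add]
    refine tsum_congr fun i => ?_
    rw [hE, ← modularOn_union (hG i) Set.disjoint_sdiff_left, Set.sdiff_union_of_subset (hGc i)]
  have hEsmall : ∑' i, modularOn p (E (c i)) (t i) ≤ ENNReal.ofReal (l ^ K) := by
    have h1 : ∑' i, modularOn p (E (c i)) (t i) + ENNReal.ofReal (ρ ^ K) ≤
        ENNReal.ofReal (l ^ K) + ENNReal.ofReal (ρ ^ K) := by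
      rw [← ENNReal.ofReal_add hlK0.le (by positivity), hρK]
      simp only [add_sub_cancel, ENNReal.ofReal_one]
      rw [← hρK]
      exact (add_le_add_right hGbig.le _).trans (hsplit ▸ hsum)
    exact (ENNReal.add_le_add_iff_right ENNReal.ofReal_ne_top).1 h1
  have hEnorm : varNorm p (stepFun (Set.range c) t' E) ≤ ENNReal.ofReal l := by
    refine iInf_le_of_le l (iInf_le_of_le hlpos (iInf_le_of_le ?_ le_rfl))
    rw [lintegral_stepFun hp hc hinj (fun i => by rw [ht']; exact ht i) hEm
      (fun i => by rw [hE]; exact Set.sdiff_subset)]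
    calc ∑' i, modularOn p (E (c i)) (t' (c i) / l)
        ≤ ∑' i, ENNReal.ofReal (l⁻¹ ^ K) * modularOn p (E (c i)) (t i) := by
          refine ENNReal.tsum_le_tsum fun i => ?_
          rw [div_eq_inv_mul, ht']
          exact modularOn_mul_le hp _ ((one_le_inv₀ hlpos).2 (by linarith)) (ht i)
      _ ≤ ENNReal.ofReal (l⁻¹ ^ K) * ENNReal.ofReal (l ^ K) := by
          rw [ENNReal.tsum_mul_left]; gcongr
      _ = 1 := by
          rw [← ENNReal.ofReal_mul (by positivity), ← Real.mul_rpow (by positivity) hlpos.le,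
            inv_mul_cancel₀ hlpos.ne', Real.one_rpow, ENNReal.ofReal_one]
  have hEvol : ∀ i, ENNReal.ofReal lam * volume (c i).toSet ≤ volume (E (c i)) := by
    intro i
    rw [hE]
    have h1 : volume (c i).toSet ≤ volume ((c i).toSet \ G i) + volume (G i) := by
      refine (measure_mono ?_).trans (measure_union_le _ _)
      rw [Set.sdiff_union_of_subset (hGc i)]
    have h2 : volume (c i).toSet = ENNReal.ofReal lam * volume (c i).toSet +
        ENNReal.ofReal (1 - lam) * volume (c i).toSet := by
      rw [← add_mul, ← ENNReal.ofReal_add hl0.le (by linarith)]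
      simp
    have h3 := h1.trans (add_le_add_right (hvol i) _)
    nth_rw 1 [h2] at h3
    exact (ENNReal.add_le_add_iff_right
      (ENNReal.mul_ne_top ENNReal.ofReal_ne_top (c i).volume_ne_top)).1 h3
  have hnorm : varNorm p (stepFun (Set.range c) t' Cube.toSet) < ENNReal.ofReal (1 / 2) := by
    refine (hA (Set.range c) t' E ?_ ?_ ?_).trans_lt ?_
    · rintro _ ⟨i, rfl⟩ _ ⟨j, rfl⟩ hij
      exact hc fun h => hij (h ▸ rfl)
    · rintro _ ⟨i, rfl⟩
      rw [ht']; exact ht i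
    · rintro _ ⟨i, rfl⟩
      exact ⟨hEm i, by rw [hE]; exact Set.sdiff_subset, hEvol i⟩
    · calc ENNReal.ofReal C * varNorm p (stepFun (Set.range c) t' E)
          ≤ ENNReal.ofReal C * ENNReal.ofReal l := by gcongr
        _ = ENNReal.ofReal (C * l) := (ENNReal.ofReal_mul hC.le).symm
        _ < ENNReal.ofReal (1 / 2) :=
          (ENNReal.ofReal_lt_ofReal_iff (by norm_num)).2 (by linarith)
  simp only [varNorm, iInf_lt_iff] at hnorm
  obtain ⟨m, hm0, hm, hm2⟩ := hnorm
  rw [ENNReal.ofReal_lt_ofReal_iff (by norm_num)] at hm2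
  rw [lintegral_stepFun hp hc hinj (fun i => by rw [ht']; exact ht i)
      (fun i => (c i).measurableSet_toSet.nullMeasurableSet) (fun i => subset_rfl)] at hm
  have hm' : ENNReal.ofReal m⁻¹ * ∑' i, modularOn p (c i).toSet (t i) ≤ 1 := by
    refine le_trans ?_ hm
    rw [← ENNReal.tsum_mul_left]
    refine ENNReal.tsum_le_tsum fun i => ?_
    rw [ht', div_eq_inv_mul]
    exact mul_modularOn_le hp _ ((one_le_inv₀ hm0).2 (by linarith)) (ht i)
  have hlow : ENNReal.ofReal (1 / 2) < ∑' i, modularOn p (c i).toSet (t i) :=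
    calc ENNReal.ofReal (1 / 2) ≤ ENNReal.ofReal (ρ ^ K) :=
          ENNReal.ofReal_le_ofReal (by linarith)
      _ < ∑' i, modularOn p (G i) (t i) := hGbig
      _ ≤ _ := ENNReal.tsum_le_tsum fun i => modularOn_mono_set (hGc i) _
  have : (1 : ℝ≥0∞) < 1 := by
    calc (1 : ℝ≥0∞) ≤ ENNReal.ofReal (m⁻¹ * (1 / 2)) := by
          rw [ENNReal.one_le_ofReal, ← div_eq_inv_mul, le_div_iff₀ hm0]
          linarith
      _ = ENNReal.ofReal m⁻¹ * ENNReal.ofReal (1 / 2) := ENNReal.ofReal_mul (by positivity)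
      _ < ENNReal.ofReal m⁻¹ * ∑' i, modularOn p (c i).toSet (t i) := by
          rwa [ENNReal.mul_lt_mul_iff_right (by simpa using hm0) ENNReal.ofReal_ne_top]
      _ ≤ 1 := hm'
  exact lt_irrefl _ this

/-- Iterating along stopping cubes, the decay becomes a power of the relative measure. -/
lemma HasModularDecay.pow {n : ℕ} {p : (Fin n → ℝ) → ℝ} {g ρ κ : ℝ} (hρ : 0 < ρ)
    (h : HasModularDecay p g ρ) (hκ0 : 0 < κ) (hκ1 : κ < 1) (hκg : 2 ^ n * κ ≤ g) (N : ℕ) :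
    HasModularDecay p ((κ / 2) ^ N) (ρ ^ N) := by
  induction N with
  | zero =>
    intro ι c t G hc ht hG hGc hvol hsum
    refine le_trans (ENNReal.tsum_le_tsum fun i => ?_) hsum
    simpa using modularOn_mono_set (hGc i) (t i)
  | succ N ih =>
    intro ι c t G hc ht hG hGc hvol hsum
    have hpow : 2 * (κ / 2) ^ (N + 1) ≤ κ := by
      have : (κ / 2) ^ N ≤ 1 := pow_le_one₀ (by positivity) (by linarith)
      rw [pow_succ]
      nlinarith
    -- With `a = (κ / 2) ^ (N + 1)` the stopping cubes fill at most the fraction `2 * a / κ = (κ /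
    -- 2) ^ N` of `c i`, as the induction hypothesis requires.
    choose J P hPd hPc hGP hPdens hPvol using fun i =>
      exists_stopping_cubes (c i) hκ1 (by positivity) hpow (hGc i) (hvol i)
    have hJ : ∀ i, Countable (J i) := fun i => Cube.countable_of_pairwise_disjoint (hPd i)
    have hPm : ∀ i j, NullMeasurableSet (P i j).toSet := fun i j =>
      (P i j).measurableSet_toSet.nullMeasurableSet
    have h1 := ih c t (fun i => ⋃ j, (P i j).toSet) hc ht
      (fun i => NullMeasurableSet.iUnion (hPm i)) (fun i => Set.iUnion_subset (hPc i))
      (fun i => (hPvol i).trans_eq (by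
        congr 2
        rw [pow_succ]
        field_simp)) hsum
    -- The stopping cubes at the levels `t / ρ ^ N` again have total modular at most 1, so one more
    -- decay step applies to them. This composition is why decay is stated between unit balls.
    have h2 := @h (Σ i, J i) (fun a => P a.1 a.2) (fun a => t a.1 / ρ ^ N)
      (fun a => G a.1 ∩ (P a.1 a.2).toSet) ?_ (fun a => div_nonneg (ht a.1) (by positivity))
      (fun a => (hG a.1).inter (hPm _ _)) (fun a => Set.inter_subset_right)
      (fun a => (hPdens a.1 a.2).trans (by gcongr)) ?_
    · refine le_trans (le_of_eq ?_) h2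
      rw [ENNReal.tsum_sigma']
      refine tsum_congr fun i => ?_
      dsimp only
      rw [← modularOn_iUnion (fun j => (hG i).inter (hPm i j))
        (fun j j' hjj => (hPd i hjj).mono Set.inter_subset_right Set.inter_subset_right),
        ← Set.inter_iUnion, Set.inter_eq_left.2 (hGP i), div_div, ← pow_succ]
    · rintro ⟨i, j⟩ ⟨i', j'⟩ hne
      by_cases hii : i = i'
      · subst hii
        exact hPd i fun hjj => hne (congrArg (Sigma.mk i) hjj)
      · exact (hc hii).mono (hPc i j) (hPc i' j')
    · refine le_trans (le_of_eq ?_) h1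
      rw [ENNReal.tsum_sigma']
      refine tsum_congr fun i => ?_
      dsimp only
      rw [← modularOn_iUnion (hPm i) (hPd i)]

/-! ### Modular estimates on cubes and level sets -/

section estimates

variable {n : ℕ} {p : (Fin n → ℝ) → ℝ} {K : ℝ}

lemma HasModularDecay.mono_right (hp : IsBoundedExponent p K) {g ρ ρ' : ℝ} (hρ : 0 < ρ)
    (hρρ' : ρ ≤ ρ') (h : HasModularDecay p g ρ) : HasModularDecay p g ρ' := by
  intro ι c t G hc ht hG hGc hvol hsum
  refine le_trans (ENNReal.tsum_le_tsum fun i => ?_) (h c t G hc ht hG hGc hvol hsum)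
  exact modularOn_mono hp _ (div_nonneg (ht i) (hρ.le.trans hρρ'))
    (div_le_div_of_nonneg_left (ht i) hρ hρρ')

lemma HasModularDecay.tsum_le (hp : IsBoundedExponent p K) {g r : ℝ} (hr0 : 0 < r) (hr1 : r ≤ 1)
    (h : HasModularDecay p g r) {ι : Type} {c : ι → Cube n} {t : ι → ℝ}
    {G : ι → Set (Fin n → ℝ)} (hc : Pairwise (Function.onFun Disjoint fun i => (c i).toSet))
    (ht : ∀ i, 0 ≤ t i) (hG : ∀ i, NullMeasurableSet (G i)) (hGc : ∀ i, G i ⊆ (c i).toSet)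
    (hvol : ∀ i, volume (G i) ≤ ENNReal.ofReal g * volume (c i).toSet)
    (hsum : ∑' i, modularOn p (c i).toSet (t i) ≤ 1) :
    ∑' i, modularOn p (G i) (t i) ≤ ENNReal.ofReal r := by
  have h1 := h c t G hc ht hG hGc hvol hsum
  have h2 : ENNReal.ofReal r⁻¹ * ∑' i, modularOn p (G i) (t i) ≤ 1 := by
    refine le_trans ?_ h1
    rw [← ENNReal.tsum_mul_left]
    refine ENNReal.tsum_le_tsum fun i => ?_
    rw [div_eq_inv_mul]
    exact mul_modularOn_le hp _ ((one_le_inv₀ hr0).2 hr1) (ht i)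
  calc ∑' i, modularOn p (G i) (t i)
      = ENNReal.ofReal r * (ENNReal.ofReal r⁻¹ * ∑' i, modularOn p (G i) (t i)) := by
        rw [← mul_assoc, ← ENNReal.ofReal_mul hr0.le, mul_inv_cancel₀ hr0.ne', ENNReal.ofReal_one,
          one_mul]
    _ ≤ ENNReal.ofReal r * 1 := by gcongr
    _ = _ := mul_one _

lemma HasModularDecay.le_of_single (hp : IsBoundedExponent p K) {g r : ℝ} (hr0 : 0 < r)
    (hr1 : r ≤ 1) (h : HasModularDecay p g r) {Q : Cube n} {t : ℝ} {G : Set (Fin n → ℝ)}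
    (ht : 0 ≤ t) (hG : NullMeasurableSet G) (hGQ : G ⊆ Q.toSet)
    (hvol : volume G ≤ ENNReal.ofReal g * volume Q.toSet) (hQ : modularOn p Q.toSet t ≤ 1) :
    modularOn p G t ≤ ENNReal.ofReal r := by
  have := h.tsum_le hp hr0 hr1 (ι := Unit) (c := fun _ => Q) (t := fun _ => t) (G := fun _ => G)
    (fun i j hij => absurd rfl hij) (fun _ => ht) (fun _ => hG) (fun _ => hGQ) (fun _ => hvol)
    (by simpa using hQ)
  simpa using this

lemma modularOn_ne_top (hp : IsBoundedExponent p K) (Q : Cube n) {t : ℝ} (ht : 0 ≤ t) :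
    modularOn p Q.toSet t ≠ ⊤ := by
  have h : modularOn p Q.toSet t ≤ ENNReal.ofReal ((max 1 t) ^ K) * volume Q.toSet := by
    rw [← setLIntegral_const]
    refine lintegral_mono fun x => ENNReal.ofReal_le_ofReal ?_
    calc t ^ p x ≤ (max 1 t) ^ p x := Real.rpow_le_rpow ht (le_max_right _ _) (hp.pos x).le
      _ ≤ (max 1 t) ^ K := Real.rpow_le_rpow_of_exponent_le (le_max_left _ _) (hp.le x)
  exact (h.trans_lt (ENNReal.mul_lt_top ENNReal.ofReal_lt_top Q.volume_ne_top.lt_top)).ne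

lemma modularOn_ne_zero (hp : IsBoundedExponent p K) (Q : Cube n) {t : ℝ} (ht : 0 < t) :
    modularOn p Q.toSet t ≠ 0 := by
  have h : ENNReal.ofReal ((min 1 t) ^ K) * volume Q.toSet ≤ modularOn p Q.toSet t := by
    rw [← setLIntegral_const]
    refine lintegral_mono fun x => ENNReal.ofReal_le_ofReal ?_
    calc (min 1 t) ^ K ≤ (min 1 t) ^ p x :=
          Real.rpow_le_rpow_of_exponent_ge (by positivity) (min_le_left _ _) (hp.le x)
      _ ≤ t ^ p x := Real.rpow_le_rpow (by positivity) (min_le_right _ _) (hp.pos x).le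
  have h0 : 0 < ENNReal.ofReal ((min 1 t) ^ K) * volume Q.toSet :=
    ENNReal.mul_pos (by simpa using Real.rpow_pos_of_pos (lt_min one_pos ht) K) Q.volume_ne_zero
  exact (h0.trans_le h).ne'

/-- Hölder's inequality for modulars of constants. -/
lemma modularOn_rpow_le (hp : IsBoundedExponent p K) (S : Set (Fin n → ℝ)) {t τ : ℝ} (ht : 0 ≤ t)
    (h0 : 0 ≤ τ) (h1 : τ ≤ 1) :
    modularOn p S (t ^ τ) ≤ modularOn p S t ^ τ * volume S ^ (1 - τ) := by
  have h := ENNReal.lintegral_mul_norm_pow_le (μ := volume.restrict S)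
    (hp.measurable_rpow t).aemeasurable (g := fun _ => 1) aemeasurable_const h0
    (show 0 ≤ 1 - τ by linarith) (by ring)
  simp only [ENNReal.one_rpow, mul_one, lintegral_const, Measure.restrict_apply_univ,
    one_mul] at h
  refine le_trans (le_of_eq ?_) h
  refine lintegral_congr fun x => ?_
  rw [ENNReal.ofReal_rpow_of_nonneg (by positivity) h0, ← Real.rpow_mul ht, ← Real.rpow_mul ht,
    mul_comm]

lemma continuousOn_modularOn (hp : IsBoundedExponent p K) (Q : Cube n) :
    ContinuousOn (fun t => modularOn p Q.toSet t) (Set.Ioi 0) := by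
  intro t ht
  refine ContinuousAt.continuousWithinAt ?_
  have ht' : 0 < t := ht
  refine tendsto_lintegral_filter_of_dominated_convergence
    (fun x => ENNReal.ofReal ((2 * t) ^ p x)) (.of_forall fun s => hp.measurable_rpow s) ?_ ?_ ?_
  · filter_upwards [Ioo_mem_nhds ht' (show t < 2 * t by linarith)] with s hs
    refine .of_forall fun x => ENNReal.ofReal_le_ofReal ?_
    exact Real.rpow_le_rpow hs.1.le hs.2.le (hp.pos x).le
  · exact modularOn_ne_top hp Q (by positivity)
  · refine .of_forall fun x => (ENNReal.continuous_ofReal.tendsto _).comp ?_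
    exact (Real.continuousAt_rpow_const _ _ (Or.inl ht'.ne')).tendsto

/-- A subset carrying half of the modular of `t` on `Q` decomposes into level sets which control
the modular of the larger number `t ^ (1 - d)` on `Q`. -/
lemma exists_levelSets (hp : IsBoundedExponent p K) {θ δ d t : ℝ} (hθ0 : 0 < θ) (hθ : θ ≤ 1 / 4)
    (hd0 : 0 ≤ d) (hdδ : d ≤ δ) (hδ1 : δ ≤ 1) (ht : 0 < t) (M : ℕ) (Q : Cube n)
    {G : Set (Fin n → ℝ)} (hG : NullMeasurableSet G) (hGQ : G ⊆ Q.toSet)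
    (hvol : volume G ≤ ENNReal.ofReal (θ ^ M) * volume Q.toSet)
    (hbad : modularOn p Q.toSet t ≤ 2 * modularOn p G t) :
    ∃ L : ℕ → Set (Fin n → ℝ), (∀ k, NullMeasurableSet (L k)) ∧ (∀ k, L k ⊆ G) ∧
      (∀ k, volume (L k) ≤ ENNReal.ofReal (θ ^ max M (k - 1)) * volume Q.toSet) ∧
      modularOn p Q.toSet (t ^ (1 - d)) ≤
        4 * ∑' k, ENNReal.ofReal (((θ ^ δ)⁻¹) ^ (k + 1)) * modularOn p (L k) (t ^ (1 - d)) := by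
  set v : ℝ := Q.side ^ n with hv
  have hv0 : 0 < v := pow_pos Q.side_pos n
  have hV : volume Q.toSet = ENNReal.ofReal v := Q.volume_toSet
  -- `A` is the mean of `t ^ p` over `Q`.
  set A : ℝ := (modularOn p Q.toSet t).toReal / v with hA
  have hA0 : 0 < A := div_pos (ENNReal.toReal_pos (modularOn_ne_zero hp Q ht)
    (modularOn_ne_top hp Q ht.le)) hv0
  have hmod : modularOn p Q.toSet t = ENNReal.ofReal (A * v) := by
    rw [hA, div_mul_cancel₀ _ hv0.ne', ENNReal.ofReal_toReal (modularOn_ne_top hp Q ht.le)]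
  have hmeas : Measurable fun x => t ^ p x := measurable_const.pow hp.measurable
  set L : ℕ → Set (Fin n → ℝ) := fun k =>
    G ∩ (fun x => t ^ p x) ⁻¹' Set.Ico (A / 4 * θ⁻¹ ^ k) (A / 4 * θ⁻¹ ^ (k + 1)) with hL
  have hLm : ∀ k, NullMeasurableSet (L k) := fun k =>
    hG.inter (hmeas measurableSet_Ico).nullMeasurableSet
  have hθδ : 0 < θ ^ δ := Real.rpow_pos_of_pos hθ0 δ
  have hθi : 1 ≤ θ⁻¹ := (one_le_inv₀ hθ0).2 (by linarith)
  refine ⟨L, hLm, fun k => Set.inter_subset_left, fun k => ?_, ?_⟩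
  · rcases le_total (k - 1) M with h | h
    · rw [max_eq_left h]
      exact (measure_mono Set.inter_subset_left).trans hvol
    rw [max_eq_right h]
    -- For `k = 0` truncated subtraction gives `k - 1 = 0`, so this branch forces `M = 0`. For the
    -- others, Chebyshev's constant 4 is absorbed by one factor `θ ≤ 1/4`, whence `k - 1`.
    rcases k with _ | k
    · obtain rfl : M = 0 := by omega
      exact (measure_mono Set.inter_subset_left).trans hvol
    have h1 : ENNReal.ofReal (A / 4 * θ⁻¹ ^ (k + 1)) * volume (L (k + 1)) ≤
        modularOn p Q.toSet t := by
      rw [← setLIntegral_const]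
      calc ∫⁻ _ in L (k + 1), ENNReal.ofReal (A / 4 * θ⁻¹ ^ (k + 1))
          ≤ ∫⁻ x in L (k + 1), ENNReal.ofReal (t ^ p x) := by
            refine lintegral_mono_ae ?_
            rw [ae_restrict_iff'₀ (hLm _)]
            exact .of_forall fun x hx => ENNReal.ofReal_le_ofReal hx.2.1
        _ ≤ _ := modularOn_mono_set (Set.inter_subset_left.trans hGQ) t
    rw [hmod] at h1
    have hc : 0 < A / 4 * θ⁻¹ ^ (k + 1) := by positivity
    rw [mul_comm, ← ENNReal.le_div_iff_mul_le (Or.inl (by simpa using hc))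
      (Or.inl ENNReal.ofReal_ne_top), ← ENNReal.ofReal_div_of_pos hc] at h1
    refine h1.trans ?_
    rw [hV, ← ENNReal.ofReal_mul (by positivity)]
    refine ENNReal.ofReal_le_ofReal ?_
    simp only [Nat.add_sub_cancel]
    have : A * v / (A / 4 * θ⁻¹ ^ (k + 1)) = (4 * θ) * (θ ^ k * v) := by
      rw [inv_pow, pow_succ]
      field_simp
    rw [this]
    exact mul_le_of_le_one_left (by positivity) (by linarith)
  · -- the part of `G` where `t ^ p` is small carries a quarter of the modular
    have hlow : ENNReal.ofReal (A * v) ≤ 4 * ∑' k, modularOn p (L k) t := by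
      have hcov : G ⊆ (G ∩ (fun x => t ^ p x) ⁻¹' Set.Iio (A / 4)) ∪ ⋃ k, L k := by
        intro x hx
        rcases lt_or_ge (t ^ p x) (A / 4) with h | h
        · exact Or.inl ⟨hx, h⟩
        · right
          obtain ⟨k, hk1, hk2⟩ := exists_nat_pow_near
            (show 1 ≤ t ^ p x / (A / 4) by rw [le_div_iff₀ (by positivity)]; linarith)
            (show 1 < θ⁻¹ from (one_lt_inv₀ hθ0).2 (by linarith))
          rw [le_div_iff₀ (by positivity)] at hk1
          rw [div_lt_iff₀ (by positivity)] at hk2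
          exact Set.mem_iUnion.2 ⟨k, hx, by rw [mul_comm]; exact hk1, by rw [mul_comm]; exact hk2⟩
      have hsm : modularOn p (G ∩ (fun x => t ^ p x) ⁻¹' Set.Iio (A / 4)) t ≤
          ENNReal.ofReal (A * v / 4) := by
        calc modularOn p (G ∩ (fun x => t ^ p x) ⁻¹' Set.Iio (A / 4)) t
            ≤ ∫⁻ _ in G ∩ (fun x => t ^ p x) ⁻¹' Set.Iio (A / 4), ENNReal.ofReal (A / 4) := by
              refine lintegral_mono_ae ?_
              rw [ae_restrict_iff'₀
                (hG.inter (hmeas measurableSet_Iio).nullMeasurableSet)]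
              exact .of_forall fun x hx => ENNReal.ofReal_le_ofReal hx.2.le
          _ ≤ ENNReal.ofReal (A / 4) * ENNReal.ofReal v := by
              rw [setLIntegral_const, ← hV]
              gcongr
              exact Set.inter_subset_left.trans hGQ
          _ = _ := by rw [← ENNReal.ofReal_mul (by positivity)]; congr 1; ring
      have h1 : modularOn p G t ≤ ENNReal.ofReal (A * v / 4) + ∑' k, modularOn p (L k) t := by
        refine (modularOn_mono_set hcov t).trans ((lintegral_union_le _ _ _).trans ?_)
        exact add_le_add hsm (lintegral_iUnion_le _ _)
      have h2 : ENNReal.ofReal (A * v / 2) + ENNReal.ofReal (A * v / 2) ≤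
          ENNReal.ofReal (A * v / 2) + 2 * ∑' k, modularOn p (L k) t := by
        calc ENNReal.ofReal (A * v / 2) + ENNReal.ofReal (A * v / 2)
            = modularOn p Q.toSet t := by
              rw [← ENNReal.ofReal_add (by positivity) (by positivity), hmod]; congr 1; ring
          _ ≤ 2 * (ENNReal.ofReal (A * v / 4) + ∑' k, modularOn p (L k) t) := by
              refine hbad.trans ?_; gcongr
          _ = _ := by
              rw [mul_add, two_mul (ENNReal.ofReal _),
                ← ENNReal.ofReal_add (by positivity) (by positivity)]
              congr 2; ring
      have h3 := (ENNReal.add_le_add_iff_left ENNReal.ofReal_ne_top).1 h2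
      calc ENNReal.ofReal (A * v) = 2 * ENNReal.ofReal (A * v / 2) := by
            rw [two_mul, ← ENNReal.ofReal_add (by positivity) (by positivity)]; congr 1; ring
        _ ≤ 2 * (2 * ∑' k, modularOn p (L k) t) := by gcongr
        _ = _ := by rw [← mul_assoc]; norm_num
    -- Write `t ^ p = (t ^ p) ^ d * (t ^ (1 - d)) ^ p` and bound the first factor by the top of the
    -- slice. The resulting `A ^ d` cancels against the Hölder bound `hjensen`.
    have hstep : ∀ k, modularOn p (L k) t ≤ ENNReal.ofReal (A ^ d) *
        (ENNReal.ofReal (((θ ^ δ)⁻¹) ^ (k + 1)) * modularOn p (L k) (t ^ (1 - d))) := by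
      intro k
      rw [← mul_assoc, ← ENNReal.ofReal_mul (by positivity), modularOn, modularOn,
        ← lintegral_const_mul _ (hp.measurable_rpow _)]
      refine lintegral_mono_ae ?_
      rw [ae_restrict_iff'₀ (hLm _)]
      refine .of_forall fun x hx => ?_
      rw [← ENNReal.ofReal_mul (by positivity)]
      refine ENNReal.ofReal_le_ofReal ?_
      have hsplit : t ^ p x = (t ^ p x) ^ d * (t ^ (1 - d)) ^ p x := by
        rw [← Real.rpow_mul ht.le, ← Real.rpow_mul ht.le, ← Real.rpow_add ht]
        congr 1; ring
      have hbd : (t ^ p x) ^ d ≤ A ^ d * ((θ ^ δ)⁻¹) ^ (k + 1) := by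
        calc (t ^ p x) ^ d ≤ (A * θ⁻¹ ^ (k + 1)) ^ d := by
              refine Real.rpow_le_rpow (by positivity) (hx.2.2.le.trans ?_) hd0
              gcongr
              linarith
          _ = A ^ d * (θ⁻¹ ^ (k + 1)) ^ d := Real.mul_rpow hA0.le (by positivity)
          _ ≤ A ^ d * (θ⁻¹ ^ (k + 1)) ^ δ := by
              gcongr
              exact one_le_pow₀ hθi
          _ = A ^ d * ((θ ^ δ)⁻¹) ^ (k + 1) := by
              rw [← Real.rpow_natCast, ← Real.rpow_mul (by positivity), mul_comm _ δ,
                Real.rpow_mul (by positivity), Real.rpow_natCast, Real.inv_rpow hθ0.le]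
      calc t ^ p x = (t ^ p x) ^ d * (t ^ (1 - d)) ^ p x := hsplit
        _ ≤ _ := by gcongr
    have hAd : 0 < A ^ d := Real.rpow_pos_of_pos hA0 d
    have hjensen : modularOn p Q.toSet (t ^ (1 - d)) ≤ ENNReal.ofReal ((A ^ d)⁻¹ * (A * v)) := by
      refine (modularOn_rpow_le hp Q.toSet ht.le (by linarith) (by linarith)).trans ?_
      rw [hmod, hV, ENNReal.ofReal_rpow_of_pos (by positivity), ENNReal.ofReal_rpow_of_pos hv0,
        ← ENNReal.ofReal_mul (by positivity)]
      refine ENNReal.ofReal_le_ofReal (le_of_eq ?_)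
      rw [Real.mul_rpow hA0.le hv0.le, mul_assoc, ← Real.rpow_add hv0, Real.rpow_sub hA0]
      simp only [add_sub_cancel, Real.rpow_one]
      ring
    calc modularOn p Q.toSet (t ^ (1 - d)) ≤ ENNReal.ofReal ((A ^ d)⁻¹ * (A * v)) := hjensen
      _ = ENNReal.ofReal (A ^ d)⁻¹ * ENNReal.ofReal (A * v) :=
          ENNReal.ofReal_mul (by positivity)
      _ ≤ ENNReal.ofReal (A ^ d)⁻¹ * (4 * ∑' k, (ENNReal.ofReal (A ^ d) *
        (ENNReal.ofReal (((θ ^ δ)⁻¹) ^ (k + 1)) * modularOn p (L k) (t ^ (1 - d))))) := by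
          gcongr
          refine hlow.trans ?_
          gcongr with k
          exact hstep k
      _ = _ := by
          rw [ENNReal.tsum_mul_left, mul_left_comm, ← mul_assoc (ENNReal.ofReal (A ^ d)⁻¹),
            ← ENNReal.ofReal_mul (by positivity), inv_mul_cancel₀ hAd.ne', ENNReal.ofReal_one,
            one_mul]

end estimates

/-! ### Self-improvement at bad levels and summability of the error -/

section selfImprovement

variable {n : ℕ} {p : (Fin n → ℝ) → ℝ} {K θ δ : ℝ} {M : ℕ}

/-- The gap: slice `k` loses `r⁻¹ ^ (k + 1)`, with `r = θ ^ δ`, but decay, applied to all cubes at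
once, gains `r ^ (4 * max M (k - 1))`. The surplus sums to a geometric series. -/
lemma tsum_modularOn_le_half (hp : IsBoundedExponent p K) (hθ0 : 0 < θ) (hθ : θ ≤ 1 / 4)
    (hδ0 : 0 < δ) (hδ1 : δ ≤ 1) (hD : ∀ N : ℕ, HasModularDecay p (θ ^ N) (((θ ^ δ) ^ 4) ^ N))
    (hM : 3 ≤ M) (hMr : 8 * (θ ^ δ) ^ M ≤ 1 - θ ^ δ) {ι : Type} {c : ι → Cube n} {t d : ι → ℝ}
    {G : ι → Set (Fin n → ℝ)} (hc : Pairwise (Function.onFun Disjoint fun i => (c i).toSet))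
    (ht : ∀ i, 0 < t i) (hd0 : ∀ i, 0 ≤ d i) (hdδ : ∀ i, d i ≤ δ)
    (hG : ∀ i, NullMeasurableSet (G i)) (hGc : ∀ i, G i ⊆ (c i).toSet)
    (hvol : ∀ i, volume (G i) ≤ ENNReal.ofReal (θ ^ M) * volume (c i).toSet)
    (hbad : ∀ i, modularOn p (c i).toSet (t i) ≤ 2 * modularOn p (G i) (t i))
    (hsum : ∑' i, modularOn p (c i).toSet (t i ^ (1 - d i)) ≤ 1) :
    ∑' i, modularOn p (c i).toSet (t i ^ (1 - d i)) ≤ 1 / 2 := by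
  choose L hLm hLG hLvol hLsum using fun i =>
    exists_levelSets hp hθ0 hθ (hd0 i) (hdδ i) hδ1 (ht i) M (c i) (hG i) (hGc i) (hvol i) (hbad i)
  set r : ℝ := θ ^ δ with hr
  have hr0 : 0 < r := Real.rpow_pos_of_pos hθ0 δ
  have hr1 : r < 1 := Real.rpow_lt_one hθ0.le (by linarith) hδ0
  have hlevel : ∀ k, ENNReal.ofReal (r⁻¹ ^ (k + 1)) *
      ∑' i, modularOn p (L i k) (t i ^ (1 - d i)) ≤ ENNReal.ofReal (r ^ M) * ENNReal.ofReal r ^ k := by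
    intro k
    have h1 := HasModularDecay.tsum_le hp (by positivity)
      (pow_le_one₀ (by positivity) (pow_le_one₀ hr0.le hr1.le)) (hD (max M (k - 1))) hc
      (fun i => (Real.rpow_pos_of_pos (ht i) (1 - d i)).le) (fun i => hLm i k)
      (fun i => (hLG i k).trans (hGc i)) (fun i => hLvol i k) hsum
    calc _ ≤ ENNReal.ofReal (r⁻¹ ^ (k + 1)) * ENNReal.ofReal ((r ^ 4) ^ max M (k - 1)) := by gcongr
      _ ≤ ENNReal.ofReal (r ^ (M + k)) := by
          rw [← ENNReal.ofReal_mul (by positivity)]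
          refine ENNReal.ofReal_le_ofReal ?_
          rw [inv_pow, ← pow_mul, inv_mul_le_iff₀ (by positivity), ← pow_add]
          -- `M + 2 * k + 1 ≤ 4 * max M (k - 1)`; this is where `3 ≤ M` and the fourth power in the
          -- decay enter.
          exact pow_le_pow_of_le_one hr0.le hr1.le (by omega)
      _ = _ := by rw [pow_add, ENNReal.ofReal_mul (by positivity), ENNReal.ofReal_pow hr0.le k]
  calc ∑' i, modularOn p (c i).toSet (t i ^ (1 - d i))
      ≤ ∑' i, 4 * ∑' k, ENNReal.ofReal (r⁻¹ ^ (k + 1)) * modularOn p (L i k) (t i ^ (1 - d i)) :=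
        ENNReal.tsum_le_tsum hLsum
    _ = 4 * ∑' k, ENNReal.ofReal (r⁻¹ ^ (k + 1)) *
          ∑' i, modularOn p (L i k) (t i ^ (1 - d i)) := by
        rw [ENNReal.tsum_mul_left, ENNReal.tsum_comm]
        simp_rw [ENNReal.tsum_mul_left]
    _ ≤ 4 * ∑' k : ℕ, ENNReal.ofReal (r ^ M) * ENNReal.ofReal r ^ k := by
        gcongr 4 * ?_
        exact ENNReal.tsum_le_tsum hlevel
    _ = ENNReal.ofReal (4 * (r ^ M * (1 - r)⁻¹)) := by
        rw [ENNReal.tsum_mul_left, ENNReal.tsum_geometric, ENNReal.ofReal_mul (by norm_num),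
          ENNReal.ofReal_mul (by positivity), ENNReal.ofReal_inv_of_pos (by linarith),
          ENNReal.ofReal_sub _ hr0.le]
        simp
    _ ≤ ENNReal.ofReal (1 / 2) := by
        refine ENNReal.ofReal_le_ofReal ?_
        rw [← div_eq_mul_inv, ← mul_div_assoc, div_le_iff₀ (by linarith)]
        linarith
    _ = 1 / 2 := by
        rw [ENNReal.ofReal_div_of_pos (by norm_num)]; simp

/-- `t` violates the modular comparison on `Q` for some complement of a set of small measure. -/
def IsBadLevel (p : (Fin n → ℝ) → ℝ) (g : ℝ) (Q : Cube n) (t : ℝ) : Prop :=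
  0 < t ∧ t < 1 ∧ modularOn p Q.toSet t ≤ 1 ∧ ∃ G, NullMeasurableSet G ∧ G ⊆ Q.toSet ∧
    volume G ≤ ENNReal.ofReal g * volume Q.toSet ∧ modularOn p Q.toSet t ≤ 2 * modularOn p G t

/-- The standing parameters: at all scales the modular decays like a power of the measure. -/
structure DecayParams (p : (Fin n → ℝ) → ℝ) (K θ δ : ℝ) (M : ℕ) : Prop where
  exponent : IsBoundedExponent p K
  theta_pos : 0 < θ
  theta_le : θ ≤ 1 / 4
  delta_pos : 0 < δ
  delta_lt : δ < 1
  decay : ∀ N : ℕ, HasModularDecay p (θ ^ N) (((θ ^ δ) ^ 4) ^ N)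
  three_le : 3 ≤ M
  pow_le : 8 * (θ ^ δ) ^ M ≤ 1 - θ ^ δ

lemma IsBadLevel.modularOn_rpow_le_half (h : DecayParams p K θ δ M) {Q : Cube n} {t d : ℝ}
    (hb : IsBadLevel p (θ ^ M) Q t) (hd0 : 0 ≤ d) (hd : d ≤ δ)
    (hle : modularOn p Q.toSet (t ^ (1 - d)) ≤ 1) :
    modularOn p Q.toSet (t ^ (1 - d)) ≤ 1 / 2 := by
  obtain ⟨ht0, ht1, _, G, hG, hGQ, hvol, hbad⟩ := hb
  have := tsum_modularOn_le_half h.exponent h.theta_pos h.theta_le h.delta_pos h.delta_lt.le h.decay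
    h.three_le h.pow_le (ι := Unit) (c := fun _ => Q) (t := fun _ => t) (d := fun _ => d)
    (G := fun _ => G) (fun i j hij => absurd rfl hij) (fun _ => ht0) (fun _ => hd0) (fun _ => hd)
    (fun _ => hG) (fun _ => hGQ) (fun _ => hvol) (fun _ => hbad) (by simpa using hle)
  simpa using this

/-- The modular of `t ^ (1 - d)` is at most 1 at `d = 0` and continuous in `d`; to exceed 1 it would
have to take the value 1, which the gap forbids. -/
lemma IsBadLevel.modularOn_rpow_le_one (h : DecayParams p K θ δ M) {Q : Cube n} {t : ℝ}
    (hb : IsBadLevel p (θ ^ M) Q t) : modularOn p Q.toSet (t ^ (1 - δ)) ≤ 1 := by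
  by_contra! hcon
  have ht0 := hb.1
  have hcont : ContinuousOn (fun d => modularOn p Q.toSet (t ^ (1 - d))) (Set.Icc 0 δ) := by
    refine (continuousOn_modularOn h.exponent Q).comp ?_ fun d _ => Real.rpow_pos_of_pos ht0 _
    exact (Continuous.rpow continuous_const (by fun_prop) fun _ => Or.inl ht0.ne').continuousOn
  obtain ⟨d, hd, hd1⟩ := intermediate_value_Icc h.delta_pos.le hcont
    (show (1 : ℝ≥0∞) ∈ _ from ⟨by simpa using hb.2.2.1, hcon.le⟩)
  have := hb.modularOn_rpow_le_half h hd.1 hd.2 hd1.le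
  simp only at hd1
  rw [hd1] at this
  norm_num at this

/-- Adding one cube raises a sum of at most `1/2` to at most 1, and the gap brings it back to `1/2`.
-/
lemma IsBadLevel.sum_le_half (h : DecayParams p K θ δ M) {t : Cube n → ℝ} (S : Finset (Cube n))
    (hS : DisjointCubes (S : Set (Cube n))) (hb : ∀ Q ∈ S, IsBadLevel p (θ ^ M) Q (t Q)) :
    ∑ Q ∈ S, modularOn p Q.toSet (t Q ^ (1 - δ)) ≤ 1 / 2 := by
  classical
  induction S using Finset.induction_on with
  | empty => simp
  | insert R S hR ih =>
    have h1 : ∑ Q ∈ insert R S, modularOn p Q.toSet (t Q ^ (1 - δ)) ≤ 1 := by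
      rw [Finset.sum_insert hR]
      have hRb := hb R (Finset.mem_insert_self _ _)
      refine (add_le_add (hRb.modularOn_rpow_le_half h h.delta_pos.le le_rfl
        (hRb.modularOn_rpow_le_one h))
        (ih (hS.mono (by simp)) fun Q hQ => hb Q (Finset.mem_insert_of_mem hQ))).trans ?_
      simp [ENNReal.inv_two_add_inv_two]
    choose! G hG hGQ hvol hbad using fun Q hQ => (hb Q hQ).2.2.2
    have h2 := tsum_modularOn_le_half h.exponent h.theta_pos h.theta_le h.delta_pos h.delta_lt.le
      h.decay h.three_le h.pow_le (ι := ↥(insert R S)) (c := fun Q => Q) (t := fun Q => t Q)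
      (d := fun _ => δ) (G := fun Q => G Q)
      (fun Q Q' hne => hS Q.2 Q'.2 fun he => hne (Subtype.ext he))
      (fun Q => (hb Q Q.2).1) (fun _ => h.delta_pos.le) (fun _ => le_rfl)
      (fun Q => hG Q Q.2) (fun Q => hGQ Q Q.2) (fun Q => hvol Q Q.2) (fun Q => hbad Q Q.2)
    simp only [tsum_fintype] at h2
    rw [Finset.sum_coe_sort (insert R S) fun Q => modularOn p Q.toSet (t Q ^ (1 - δ))] at h2
    exact h2 h1

/-- The largest value of `t ^ (-δ) ∫_Q t ^ p` over the bad levels `t` of `Q`. -/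
noncomputable def badSup (p : (Fin n → ℝ) → ℝ) (g δ : ℝ) (Q : Cube n) : ℝ≥0∞ :=
  ⨆ (t : ℝ) (_ : IsBadLevel p g Q t), ENNReal.ofReal (t ^ (-δ)) * modularOn p Q.toSet t

lemma rpow_neg_mul_modularOn_le (hp : IsBoundedExponent p K) (S : Set (Fin n → ℝ)) {t : ℝ}
    (ht0 : 0 < t) (ht1 : t < 1) (hδ0 : 0 ≤ δ) :
    ENNReal.ofReal (t ^ (-δ)) * modularOn p S t ≤ modularOn p S (t ^ (1 - δ)) := by
  rw [modularOn, ← lintegral_const_mul _ (hp.measurable_rpow t)]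
  refine lintegral_mono fun x => ?_
  rw [← ENNReal.ofReal_mul (by positivity)]
  refine ENNReal.ofReal_le_ofReal ?_
  rw [← Real.rpow_add ht0, ← Real.rpow_mul ht0.le]
  refine Real.rpow_le_rpow_of_exponent_ge ht0 ht1.le ?_
  nlinarith [hp.one_le x]

lemma tsum_badSup_le_one (h : DecayParams p K θ δ M) {F : Set (Cube n)} (hF : DisjointCubes F) :
    ∑' Q : F, badSup p (θ ^ M) δ Q ≤ 1 := by
  classical
  have hle : ∀ {Q t}, IsBadLevel p (θ ^ M) Q t → ENNReal.ofReal (t ^ (-δ)) * modularOn p Q.toSet t ≤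
      modularOn p Q.toSet (t ^ (1 - δ)) := fun hb =>
    rpow_neg_mul_modularOn_le h.exponent _ hb.1 hb.2.1 h.delta_pos.le
  have hfin : ∀ Q, badSup p (θ ^ M) δ Q ≠ ⊤ := fun Q => by
    refine ne_top_of_le_ne_top ENNReal.one_ne_top (iSup₂_le fun t hb => ?_)
    exact (hle hb).trans (hb.modularOn_rpow_le_one h)
  -- The supremum need not be attained; choosing a level within a factor 2 of it is paid for by the
  -- bound `1/2` on sums.
  have hex : ∀ Q, badSup p (θ ^ M) δ Q ≠ 0 → ∃ t, IsBadLevel p (θ ^ M) Q t ∧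
      badSup p (θ ^ M) δ Q ≤ 2 * modularOn p Q.toSet (t ^ (1 - δ)) := by
    intro Q hQ
    have hhalf := ENNReal.half_lt_self hQ (hfin Q)
    conv_rhs at hhalf => rw [badSup]
    simp only [lt_iSup_iff] at hhalf
    obtain ⟨t, hb, ht⟩ := hhalf
    refine ⟨t, hb, ?_⟩
    have := (ht.trans_le (hle hb)).le
    rw [ENNReal.div_le_iff_le_mul (by simp) (by simp)] at this
    rwa [mul_comm]
  choose! t hb ht using hex
  rw [ENNReal.tsum_eq_iSup_sum]
  refine iSup_le fun S => ?_
  let S' : Finset (Cube n) := (S.map (Function.Embedding.subtype _)).filter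
    fun Q => badSup p (θ ^ M) δ Q ≠ 0
  have hS' : (S' : Set (Cube n)) ⊆ F := by
    intro Q hQ
    simp only [S', Finset.coe_filter, Finset.mem_map] at hQ
    obtain ⟨⟨R, _, rfl⟩, _⟩ := hQ
    exact R.2
  have hb' : ∀ Q ∈ S', badSup p (θ ^ M) δ Q ≠ 0 := fun Q hQ => (Finset.mem_filter.1 hQ).2
  calc ∑ Q ∈ S, badSup p (θ ^ M) δ Q = ∑ Q ∈ S', badSup p (θ ^ M) δ Q := by
        rw [Finset.sum_filter_ne_zero, Finset.sum_map]
        rfl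
    _ ≤ ∑ Q ∈ S', 2 * modularOn p Q.toSet (t Q ^ (1 - δ)) :=
        Finset.sum_le_sum fun Q hQ => ht Q (hb' Q hQ)
    _ = 2 * ∑ Q ∈ S', modularOn p Q.toSet (t Q ^ (1 - δ)) := (Finset.mul_sum _ _ _).symm
    _ ≤ 2 * (1 / 2) := by
        gcongr
        exact IsBadLevel.sum_le_half h S' (hF.mono hS') fun Q hQ => hb Q (hb' Q hQ)
    _ = 1 := by rw [one_div]; exact ENNReal.mul_inv_cancel (by simp) (by simp)

lemma badSup_le_one (h : DecayParams p K θ δ M) (Q : Cube n) : badSup p (θ ^ M) δ Q ≤ 1 :=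
  iSup₂_le fun _ hb => (rpow_neg_mul_modularOn_le h.exponent _ hb.1 hb.2.1 h.delta_pos.le).trans
    (hb.modularOn_rpow_le_one h)

lemma IsBadLevel.modularOn_le {g : ℝ} {Q : Cube n} {t : ℝ} (hb : IsBadLevel p g Q t) :
    modularOn p Q.toSet t ≤ ENNReal.ofReal (t ^ δ) * badSup p g δ Q := by
  have ht := hb.1
  calc modularOn p Q.toSet t
      = ENNReal.ofReal (t ^ δ) * (ENNReal.ofReal (t ^ (-δ)) * modularOn p Q.toSet t) := by
        rw [← mul_assoc, ← ENNReal.ofReal_mul (by positivity), ← Real.rpow_add ht]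
        simp
    _ ≤ _ := by
        gcongr
        exact le_iSup₂ (f := fun t (_ : IsBadLevel p g Q t) =>
          ENNReal.ofReal (t ^ (-δ)) * modularOn p Q.toSet t) t hb

/-- For levels `t ≥ 1` a set of small measure never carries half of the modular. -/
lemma two_mul_modularOn_le_of_one_le (h : DecayParams p K θ δ M) {N : ℕ}
    (hN : ((θ ^ δ) ^ 4) ^ N ≤ 1 / 4) (hMN : 4 * (θ ^ δ) ^ M ≤ θ ^ N) {Q : Cube n} {t : ℝ}
    (ht : 1 ≤ t) (hQ : modularOn p Q.toSet t ≤ 1) {G : Set (Fin n → ℝ)}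
    (hG : NullMeasurableSet G) (hGQ : G ⊆ Q.toSet)
    (hvol : volume G ≤ ENNReal.ofReal (θ ^ M) * volume Q.toSet) :
    2 * modularOn p G t ≤ modularOn p Q.toSet t := by
  have hp := h.exponent
  have hθ0 := h.theta_pos
  have ht0 : 0 < t := by linarith
  set r : ℝ := θ ^ δ with hr
  have hr0 : 0 < r := Real.rpow_pos_of_pos hθ0 δ
  have hr1 : r < 1 := Real.rpow_lt_one hθ0.le (by linarith [h.theta_le]) h.delta_pos
  have hθr : θ ≤ r := by
    simpa using Real.rpow_le_rpow_of_exponent_ge hθ0 (by linarith [h.theta_le]) h.delta_lt.le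
  set v : ℝ := Q.side ^ n with hv
  have hv0 : 0 < v := pow_pos Q.side_pos n
  have hV : volume Q.toSet = ENNReal.ofReal v := Q.volume_toSet
  -- the level of full modular
  obtain ⟨T, htT, hT⟩ : ∃ T, t ≤ T ∧ modularOn p Q.toSet T = 1 := by
    have hm0 := modularOn_ne_zero hp Q ht0
    have hmt := modularOn_ne_top hp Q ht0.le
    set R : ℝ := (modularOn p Q.toSet t).toReal⁻¹ with hR
    have hR1 : 1 ≤ R := (one_le_inv₀ (ENNReal.toReal_pos hm0 hmt)).2
      (ENNReal.toReal_le_of_le_ofReal zero_le_one (by simpa using hQ))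
    have htR : t ≤ R * t := le_mul_of_one_le_left ht0.le hR1
    have hbig : 1 ≤ modularOn p Q.toSet (R * t) := by
      refine le_trans (le_of_eq ?_) (mul_modularOn_le hp Q.toSet hR1 ht0.le)
      rw [hR, ENNReal.ofReal_inv_of_pos (ENNReal.toReal_pos hm0 hmt), ENNReal.ofReal_toReal hmt,
        ENNReal.inv_mul_cancel hm0 hmt]
    obtain ⟨T, hT, hT1⟩ := intermediate_value_Icc htR
      ((continuousOn_modularOn hp Q).mono fun s hs => ht0.trans_le hs.1)
      (show (1 : ℝ≥0∞) ∈ _ from ⟨hQ, hbig⟩)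
    exact ⟨T, hT.1, hT1⟩
  have hT1 : 1 ≤ T := ht.trans htT
  have hT0 : 0 < T := by linarith
  obtain ⟨τ, hτ0, hτ1, hτ⟩ : ∃ τ : ℝ, 0 ≤ τ ∧ τ ≤ 1 ∧ T ^ τ = t := by
    refine ⟨Real.log t / Real.log T, div_nonneg (Real.log_nonneg ht) (Real.log_nonneg hT1),
      div_le_one_of_le₀ (Real.log_le_log ht0 htT) (Real.log_nonneg hT1), ?_⟩
    -- If `T = 1` then `t = 1`, and the quotient `0 / 0 = 0` still gives `T ^ τ = t`.
    rcases hT1.eq_or_lt with h1 | h1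
    · have : t = 1 := by linarith
      simp [this]
    · rw [Real.rpow_def_of_pos hT0, mul_div_cancel₀ _ (Real.log_pos h1).ne', Real.exp_log ht0]
  -- the set where `T ^ p` is comparable to its mean
  have hmeas : Measurable fun x => T ^ p x := measurable_const.pow hp.measurable
  set B : Set (Fin n → ℝ) := {x | 1 / (2 * v) ≤ T ^ p x} with hB
  have hBm : MeasurableSet B := measurableSet_le measurable_const hmeas
  have hQB : NullMeasurableSet (Q.toSet ∩ B) :=
    (Q.measurableSet_toSet.inter hBm).nullMeasurableSet
  -- Otherwise decay leaves at most `1/4` of the modular of `T` on `B`, and off `B` there is at most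
  -- `1/2`, short of the total 1.
  have hlarge : ENNReal.ofReal (θ ^ N) * volume Q.toSet ≤ volume (Q.toSet ∩ B) := by
    by_contra! hcon
    have h1 := HasModularDecay.le_of_single hp (by positivity)
      (pow_le_one₀ (by positivity) (pow_le_one₀ hr0.le hr1.le)) (h.decay N) hT0.le hQB Set.inter_subset_left
      hcon.le hT.le
    have h2 : modularOn p (Q.toSet \ B) T ≤ ENNReal.ofReal (1 / 2) := by
      calc modularOn p (Q.toSet \ B) T
          ≤ ∫⁻ _ in Q.toSet \ B, ENNReal.ofReal (1 / (2 * v)) := by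
            refine setLIntegral_mono' (Q.measurableSet_toSet.diff hBm) fun x hx => ?_
            exact ENNReal.ofReal_le_ofReal (not_le.1 hx.2).le
        _ ≤ ENNReal.ofReal (1 / (2 * v)) * ENNReal.ofReal v := by
            rw [setLIntegral_const, ← hV]
            gcongr
            exact Set.sdiff_subset
        _ = _ := by
            rw [← ENNReal.ofReal_mul (by positivity)]
            congr 1
            field_simp
    have h3 : (1 : ℝ≥0∞) ≤ ENNReal.ofReal (1 / 2) + ENNReal.ofReal (1 / 4) := by
      rw [← hT, ← Set.sdiff_union_inter Q.toSet B,
        modularOn_union hQB (Set.disjoint_sdiff_inter)]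
      exact add_le_add h2 (h1.trans (ENNReal.ofReal_le_ofReal hN))
    rw [← ENNReal.ofReal_add (by norm_num) (by norm_num), ENNReal.one_le_ofReal] at h3
    norm_num at h3
  have hvτ : 0 < v ^ τ := Real.rpow_pos_of_pos hv0 τ
  have hlow : ENNReal.ofReal (1 / 2 * (v ^ τ)⁻¹ * (θ ^ N * v)) ≤ modularOn p Q.toSet t := by
    calc ENNReal.ofReal (1 / 2 * (v ^ τ)⁻¹ * (θ ^ N * v))
        ≤ ENNReal.ofReal (1 / 2 * (v ^ τ)⁻¹) * volume (Q.toSet ∩ B) := by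
          rw [ENNReal.ofReal_mul (by positivity), ENNReal.ofReal_mul (q := v) (by positivity), ← hV]
          gcongr
      _ = ∫⁻ _ in Q.toSet ∩ B, ENNReal.ofReal (1 / 2 * (v ^ τ)⁻¹) := (setLIntegral_const _ _).symm
      _ ≤ modularOn p (Q.toSet ∩ B) t := by
          refine setLIntegral_mono' (Q.measurableSet_toSet.inter hBm) fun x hx => ?_
          refine ENNReal.ofReal_le_ofReal ?_
          calc 1 / 2 * (v ^ τ)⁻¹ ≤ (1 / 2) ^ τ * (v ^ τ)⁻¹ := by
                gcongr
                simpa using Real.rpow_le_rpow_of_exponent_ge (show (0 : ℝ) < 1 / 2 by norm_num)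
                  (by norm_num) hτ1
            _ = (1 / (2 * v)) ^ τ := by
                rw [← Real.inv_rpow hv0.le, ← Real.mul_rpow (by norm_num) (by positivity)]
                congr 1
                field_simp
            _ ≤ (T ^ p x) ^ τ := Real.rpow_le_rpow (by positivity) hx.2 hτ0
            _ = t ^ p x := by
                rw [← hτ, ← Real.rpow_mul hT0.le, ← Real.rpow_mul hT0.le, mul_comm]
      _ ≤ _ := modularOn_mono_set Set.inter_subset_left t
  -- Hölder between the modular of `T` on `G` and the volume of `G`, both small by the factor `r ^
  -- M`.
  have hup : modularOn p G t ≤ ENNReal.ofReal (r ^ M * ((v ^ τ)⁻¹ * v)) := by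
    have h1 := HasModularDecay.le_of_single hp (by positivity)
      (pow_le_one₀ (by positivity) (pow_le_one₀ hr0.le hr1.le)) (h.decay M) hT0.le hG hGQ hvol hT.le
    have h1' : modularOn p G T ≤ ENNReal.ofReal (r ^ M) :=
      h1.trans (ENNReal.ofReal_le_ofReal (pow_le_pow_left₀ (by positivity)
        (pow_le_of_le_one hr0.le hr1.le (by norm_num)) M))
    have h2 : volume G ≤ ENNReal.ofReal (r ^ M * v) := by
      refine hvol.trans ?_
      rw [hV, ← ENNReal.ofReal_mul (by positivity)]
      refine ENNReal.ofReal_le_ofReal ?_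
      gcongr
    rw [← hτ]
    calc modularOn p G (T ^ τ) ≤ modularOn p G T ^ τ * volume G ^ (1 - τ) :=
          modularOn_rpow_le hp G hT0.le hτ0 hτ1
      _ ≤ ENNReal.ofReal (r ^ M) ^ τ * ENNReal.ofReal (r ^ M * v) ^ (1 - τ) := by
          gcongr
      _ = _ := by
          have hrM : 0 < r ^ M := pow_pos hr0 M
          rw [ENNReal.ofReal_rpow_of_pos hrM, ENNReal.ofReal_rpow_of_pos (by positivity),
            ← ENNReal.ofReal_mul (by positivity), Real.mul_rpow hrM.le hv0.le, ← mul_assoc,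
            ← Real.rpow_add hrM, Real.rpow_sub hv0, Real.rpow_one]
          congr 1
          simp only [add_sub_cancel, Real.rpow_one]
          ring
  calc 2 * modularOn p G t ≤ ENNReal.ofReal 2 * ENNReal.ofReal (r ^ M * ((v ^ τ)⁻¹ * v)) := by
        rw [ENNReal.ofReal_ofNat]
        gcongr
    _ ≤ ENNReal.ofReal (1 / 2 * (v ^ τ)⁻¹ * (θ ^ N * v)) := by
        rw [← ENNReal.ofReal_mul (by norm_num)]
        refine ENNReal.ofReal_le_ofReal ?_
        have : 0 < (v ^ τ)⁻¹ * v := by positivity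
        nlinarith
    _ ≤ _ := hlow

end selfImprovement

/-! ### Reduction to bounded exponents, choice of parameters and conclusion -/

lemma varNorm_congr_ae {n : ℕ} {p q : (Fin n → ℝ) → ℝ} (h : p =ᵐ[volume] q)
    (f : (Fin n → ℝ) → ℝ) : varNorm p f = varNorm q f := by
  have : ∀ l : ℝ, ∫⁻ x, ENNReal.ofReal ((|f x| / l) ^ p x) =
      ∫⁻ x, ENNReal.ofReal ((|f x| / l) ^ q x) := fun l =>
    lintegral_congr_ae (h.mono fun x hx => by simp only [hx])
  simp only [varNorm, this]

lemma AInfty.congr_ae {n : ℕ} {p q : (Fin n → ℝ) → ℝ} (h : p =ᵐ[volume] q) (hp : AInfty p) :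
    AInfty q := by
  simpa only [AInfty, varNorm_congr_ae h] using hp

/-- A bounded exponent agrees almost everywhere with one that is measurable and bounded
everywhere. -/
lemma exists_isBoundedExponent {n : ℕ} {p : (Fin n → ℝ) → ℝ} (hp_meas : AEMeasurable p volume)
    (hp_one : ∀ x, 1 ≤ p x) {K : ℝ} (hK : ∀ᵐ x ∂(volume : Measure (Fin n → ℝ)), p x ≤ K) :
    ∃ q, IsBoundedExponent q (max 1 K) ∧ p =ᵐ[volume] q := by
  refine ⟨fun x => max 1 (min K (hp_meas.mk p x)),
    ⟨measurable_const.max (measurable_const.min hp_meas.measurable_mk), fun x => le_max_left _ _,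
      fun x => max_le_max le_rfl (min_le_left _ _)⟩, ?_⟩
  filter_upwards [hp_meas.ae_eq_mk, hK] with x hx hxK
  rw [← hx, min_eq_right hxK, max_eq_right (hp_one x)]

/-- The norm is an infimum, so admissibility is immediate only for levels `s < t`; continuity of the
modular carries it to `t`. -/
lemma modularOn_le_one_of_le_inv_varNorm {n : ℕ} {p : (Fin n → ℝ) → ℝ} {K : ℝ}
    (hp : IsBoundedExponent p K) {Q : Cube n} {t : ℝ} (ht : 0 < t)
    (h : ENNReal.ofReal t ≤ 1 / varNorm p (Q.toSet.indicator fun _ => 1)) :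
    modularOn p Q.toSet t ≤ 1 := by
  have hint : ∀ l : ℝ, ∫⁻ x, ENNReal.ofReal ((|Q.toSet.indicator (fun _ => (1 : ℝ)) x| / l) ^ p x)
      = modularOn p Q.toSet (1 / l) := by
    intro l
    rw [modularOn, ← lintegral_indicator Q.measurableSet_toSet]
    refine lintegral_congr fun x => ?_
    by_cases hx : x ∈ Q.toSet
    · simp [hx]
    · simp [hx, Real.zero_rpow (hp.pos x).ne']
  have hlt : ∀ s ∈ Set.Ioo 0 t, modularOn p Q.toSet s ≤ 1 := by
    intro s hs
    have h1 : varNorm p (Q.toSet.indicator fun _ => 1) < ENNReal.ofReal s⁻¹ := by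
      rw [one_div, ← ENNReal.inv_le_inv, inv_inv, ← ENNReal.ofReal_inv_of_pos ht] at h
      exact h.trans_lt ((ENNReal.ofReal_lt_ofReal_iff (inv_pos.2 hs.1)).2
        ((inv_lt_inv₀ ht hs.1).2 hs.2))
    simp only [varNorm, iInf_lt_iff, hint] at h1
    obtain ⟨l, hl0, hl, hls⟩ := h1
    rw [ENNReal.ofReal_lt_ofReal_iff (inv_pos.2 hs.1)] at hls
    refine (modularOn_mono hp Q.toSet hs.1.le ?_).trans hl
    rw [one_div]
    exact (lt_inv_comm₀ hl0 hs.1).1 hls |>.le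
  have hcont := ((continuousOn_modularOn hp Q).continuousAt (Ioi_mem_nhds ht)).tendsto
  refine le_of_tendsto (hcont.mono_left (nhdsWithin_le_nhds (s := Set.Iio t))) ?_
  filter_upwards [Ioo_mem_nhdsLT ht] with s hs using hlt s hs

lemma AInfty.exists_decayParams {n : ℕ} {p : (Fin n → ℝ) → ℝ} {K : ℝ}
    (hp : IsBoundedExponent p K) (hA : AInfty p) :
    ∃ (θ δ : ℝ) (M N : ℕ), DecayParams p K θ δ M ∧ ((θ ^ δ) ^ 4) ^ N ≤ 1 / 4 ∧
      4 * (θ ^ δ) ^ M ≤ θ ^ N := by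
  obtain ⟨lam, ρ, hl0, hl1, hρ0, hρ1, hdec⟩ := hA.exists_hasModularDecay hp
  set κ : ℝ := (1 - lam) / 2 ^ (n + 1) with hκ
  have hκ0 : 0 < κ := div_pos (by linarith) (by positivity)
  have h2n : (1 : ℝ) ≤ 2 ^ n := one_le_pow₀ (by norm_num)
  have hκ2 : 2 ^ n * κ = (1 - lam) / 2 := by
    rw [hκ, pow_succ]; field_simp
  have hκhalf : κ ≤ 1 / 2 := by nlinarith
  set θ : ℝ := κ / 2 with hθ
  have hθ0 : 0 < θ := by positivity
  have hθ4 : θ ≤ 1 / 4 := by linarith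
  have hlogθ : Real.log θ < 0 := Real.log_neg hθ0 (by linarith)
  have hlogρ : Real.log ρ < 0 := Real.log_neg hρ0 hρ1
  -- The second entry is the exponent with `θ ^ (4 * δ) = ρ`; a smaller `δ` keeps `ρ ≤ (θ ^ δ) ^ 4`.
  set δ : ℝ := min (1 / 2) (Real.log ρ / (4 * Real.log θ)) with hδ
  have hδ0 : 0 < δ := lt_min (by norm_num) (div_pos_of_neg_of_neg hlogρ (by linarith))
  have hδ1 : δ < 1 := (min_le_left _ _).trans_lt (by norm_num)
  set r : ℝ := θ ^ δ with hr
  have hr0 : 0 < r := Real.rpow_pos_of_pos hθ0 δ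
  have hr1 : r < 1 := Real.rpow_lt_one hθ0.le (by linarith) hδ0
  have hρr : ρ ≤ r ^ 4 := by
    have h1 : θ ^ (Real.log ρ / (4 * Real.log θ)) ≤ r :=
      Real.rpow_le_rpow_of_exponent_ge hθ0 (by linarith) (min_le_right _ _)
    calc ρ = (θ ^ (Real.log ρ / (4 * Real.log θ))) ^ 4 := by
          rw [← Real.rpow_natCast, ← Real.rpow_mul hθ0.le, Real.rpow_def_of_pos hθ0,
            ← Real.exp_log hρ0, Real.log_exp]
          congr 1
          have := hlogθ.ne
          push_cast
          field_simp
      _ ≤ r ^ 4 := by gcongr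
  have hD : ∀ N : ℕ, HasModularDecay p (θ ^ N) ((r ^ 4) ^ N) :=
    HasModularDecay.pow (by positivity) (hdec.mono_right hp hρ0 hρr) hκ0 (by linarith)
      (by rw [hκ2]; linarith)
  -- `N` is fixed before `M`, since `M` must make `(θ ^ δ) ^ M` small relative to `θ ^ N`.
  obtain ⟨N, hN⟩ := exists_pow_lt_of_lt_one (show (0 : ℝ) < 1 / 4 by norm_num)
    (pow_lt_one₀ hr0.le hr1 (show 4 ≠ 0 by norm_num))
  obtain ⟨M, hM⟩ := exists_pow_lt_of_lt_one
    (show 0 < min ((1 - r) / 8) (θ ^ N / 4) from lt_min (by linarith) (by positivity)) hr1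
  have hM' : r ^ max 3 M < min ((1 - r) / 8) (θ ^ N / 4) :=
    (pow_le_pow_of_le_one hr0.le hr1.le (le_max_right 3 M)).trans_lt hM
  have hM1 := hM'.trans_le (min_le_left _ _)
  have hM2 := hM'.trans_le (min_le_right _ _)
  exact ⟨θ, δ, max 3 M, N, ⟨hp, hθ0, hθ4, hδ0, hδ1, hD, le_max_left _ _, by linarith⟩, hN.le,
    by linarith⟩

/-- The dichotomy at a given level: either the large set `E` carries half of the modular of `Q`, or
the level is bad and the modular of `Q` is controlled by `badSup`. -/
lemma DecayParams.modularOn_le {n : ℕ} {p : (Fin n → ℝ) → ℝ} {K θ δ : ℝ} {M N : ℕ}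
    (h : DecayParams p K θ δ M) (hN : ((θ ^ δ) ^ 4) ^ N ≤ 1 / 4)
    (hMN : 4 * (θ ^ δ) ^ M ≤ θ ^ N) {Q : Cube n} {E : Set (Fin n → ℝ)} (hE : NullMeasurableSet E)
    (hEQ : E ⊆ Q.toSet) (hvol : ENNReal.ofReal (1 - θ ^ M) * volume Q.toSet ≤ volume E) {t : ℝ}
    (ht : 0 < t) (hQ : modularOn p Q.toSet t ≤ 1) :
    modularOn p Q.toSet t ≤ 2 * modularOn p E t ∨
      t < 1 ∧ modularOn p Q.toSet t ≤ ENNReal.ofReal (t ^ δ) * badSup p (θ ^ M) δ Q := by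
  have hp := h.exponent
  have hθM : θ ^ M ≤ 1 := pow_le_one₀ h.theta_pos.le (by linarith [h.theta_le])
  set G := Q.toSet \ E with hGdef
  have hG : NullMeasurableSet G := Q.measurableSet_toSet.nullMeasurableSet.diff hE
  have hGvol : volume G ≤ ENNReal.ofReal (θ ^ M) * volume Q.toSet := by
    have h1 : ENNReal.ofReal (1 - θ ^ M) * volume Q.toSet + volume G ≤
        ENNReal.ofReal (1 - θ ^ M) * volume Q.toSet + ENNReal.ofReal (θ ^ M) * volume Q.toSet := by
      rw [← add_mul, ← ENNReal.ofReal_add (by linarith) (pow_nonneg h.theta_pos.le M)]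
      simp only [sub_add_cancel, ENNReal.ofReal_one, one_mul]
      calc _ ≤ volume E + volume G := by gcongr
        _ = volume (E ∪ G) := (measure_union₀ hG Set.disjoint_sdiff_right.aedisjoint).symm
        _ = volume Q.toSet := by rw [Set.union_sdiff_cancel hEQ]
    exact (ENNReal.add_le_add_iff_left
      (ENNReal.mul_ne_top ENNReal.ofReal_ne_top Q.volume_ne_top)).1 h1
  have hsplit : modularOn p Q.toSet t = modularOn p E t + modularOn p G t := by
    rw [← modularOn_union hG Set.disjoint_sdiff_right, Set.union_sdiff_cancel hEQ]
  have hEtop : 2 * modularOn p E t ≠ ⊤ := ENNReal.mul_ne_top (by simp)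
    (ne_top_of_le_ne_top (modularOn_ne_top hp Q ht.le) (modularOn_mono_set hEQ t))
  -- One of `E`, `G` carries at least half: the two cases below follow by cancelling a finite term
  -- here.
  have hdouble : modularOn p Q.toSet t + modularOn p Q.toSet t =
      2 * modularOn p E t + 2 * modularOn p G t := by
    rw [← two_mul, hsplit, mul_add]
  rcases le_or_gt (modularOn p Q.toSet t) (2 * modularOn p E t) with hle | hgt
  · exact Or.inl hle
  rcases lt_or_ge t 1 with ht1 | ht1
  · refine Or.inr ⟨ht1, IsBadLevel.modularOn_le
      ⟨ht, ht1, hQ, G, hG, Set.sdiff_subset, hGvol, ?_⟩⟩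
    refine (ENNReal.add_le_add_iff_left hEtop).1 ?_
    rw [← hdouble]
    gcongr
  · left
    have h2 := two_mul_modularOn_le_of_one_le h hN hMN ht1 hQ hG Set.sdiff_subset hGvol
    refine (ENNReal.add_le_add_iff_right (modularOn_ne_top hp Q ht.le)).1 ?_
    rw [hdouble]
    gcongr

/-- `p` is a (Lebesgue) measurable exponent with `1 ≤ p` and `p₊ = ess sup p < ∞`. -/
theorem theorem3p1 (n : ℕ) (hn : 0 < n) (p : (Fin n → ℝ) → ℝ)
    (hp_meas : AEMeasurable p volume) (hp_one : ∀ x, 1 ≤ p x)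
    (hp_bdd : ∃ K : ℝ, ∀ᵐ x ∂(volume : Measure (Fin n → ℝ)), p x ≤ K)
    (hp : AInfty p) :
    ∃ (η δ : ℝ) (b : Cube n → ℝ),
      0 < η ∧ η < 1 ∧ 0 < δ ∧ δ < 1 ∧
      (∀ Q, 0 ≤ b Q ∧ b Q ≤ 1) ∧
      (∀ (Q : Cube n) (E : Set (Fin n → ℝ)),
        NullMeasurableSet E volume → E ⊆ Q.toSet →
        ENNReal.ofReal η * volume Q.toSet ≤ volume E →
        ∀ t : ℝ, 0 < t →
          ENNReal.ofReal t ≤ 1 / varNorm p (Q.toSet.indicator fun _ => 1) →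
          ∫⁻ x in Q.toSet, ENNReal.ofReal (t ^ p x) ≤
            2 * ((∫⁻ x in E, ENNReal.ofReal (t ^ p x)) +
              ENNReal.ofReal (t ^ δ * b Q * (Set.Ioo (0 : ℝ) 1).indicator (fun _ => 1) t))) ∧
      (∀ F : Set (Cube n), DisjointCubes F → ∑' Q : F, ENNReal.ofReal (b Q) ≤ 1) := by
  obtain ⟨K, hK⟩ := hp_bdd
  obtain ⟨q, hq, hpq⟩ := exists_isBoundedExponent hp_meas hp_one hK
  obtain ⟨θ, δ, M, N, h, hN, hMN⟩ := (hp.congr_ae hpq).exists_decayParams hq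
  have hfin : ∀ Q, badSup q (θ ^ M) δ Q ≠ ⊤ := fun Q =>
    ne_top_of_le_ne_top ENNReal.one_ne_top (badSup_le_one h Q)
  have hcongr : ∀ (S : Set (Fin n → ℝ)) (t : ℝ),
      ∫⁻ x in S, ENNReal.ofReal (t ^ p x) = modularOn q S t := fun S t =>
    lintegral_congr_ae (ae_restrict_of_ae (hpq.mono fun x hx => by simp only [hx]))
  have hθM0 : 0 < θ ^ M := pow_pos h.theta_pos M
  have hθM1 : θ ^ M < 1 := pow_lt_one₀ h.theta_pos.le (by linarith [h.theta_le])
    (by have := h.three_le; omega)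
  refine ⟨1 - θ ^ M, δ, fun Q => (badSup q (θ ^ M) δ Q).toReal, by linarith, by linarith,
    h.delta_pos, h.delta_lt, fun Q => ⟨ENNReal.toReal_nonneg, ?_⟩, ?_, fun F hF => ?_⟩
  · exact ENNReal.toReal_le_of_le_ofReal zero_le_one (by simpa using badSup_le_one h Q)
  · intro Q E hE hEQ hvol t ht htn
    rw [varNorm_congr_ae hpq] at htn
    rw [hcongr, hcongr]
    rcases h.modularOn_le hN hMN hE hEQ hvol ht
      (modularOn_le_one_of_le_inv_varNorm hq ht htn) with hle | ⟨ht1, hle⟩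
    · exact hle.trans (by gcongr; exact le_self_add)
    · rw [Set.indicator_of_mem (Set.mem_Ioo.2 ⟨ht, ht1⟩), mul_one, ENNReal.ofReal_mul (by positivity),
        ENNReal.ofReal_toReal (hfin Q)]
      calc _ ≤ _ := hle
        _ ≤ modularOn q E t + ENNReal.ofReal (t ^ δ) * badSup q (θ ^ M) δ Q := le_add_self
        _ ≤ _ := le_mul_of_one_le_left zero_le one_le_two
  · simp only [ENNReal.ofReal_toReal (hfin _)]
    exact tsum_badSup_le_one h hF
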